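/- Let $X$ be a nonempty finite set with $n=|X|$, let $r:X\times X\to X\times X$, $r(x,y)=({}^xy,x^y)$, be a bijective map, and put $\mathcal L_x(y)={}^xy$, $\mathcal R_y(x)=x^y$. Assume that $(X,r)$ is a square-free non-degenerate braided set: $r$ satisfies $r^{12}r^{23}r^{12}=r^{23}r^{12}r^{23}$ on $X^3$ (where $r^{12}=r\times\mathrm{id}_X$ and $r^{23}=\mathrm{id}_X\times r$), all maps $\mathcal L_x,\mathcal R_x$ are bijective, and $r(x,x)=(x,x)$ for all $x\in X$. Let $S=S(X,r)$, $G=G(X,r)$ and, for an arbitrary field $\mathbf k$, $A=A(\mathbf k,X,r)$ be the monoid, the group and the unital associative $\mathbf k$-algebra generated by $X$ with defining relations $xy={}^xy\cdot x^y$, where $x,y\in X$ and $r(x,y)\neq(x,y)$. Let $p$ be the least common multiple of the orders of all the permutations $\mathcal L_x,\mathcal R_x$, $x\in X$. Then the following conditions are equivalent: 1. for all $a,x,y\in X$, the equality $a x^p=a y^p$ in $S$ implies $x=y$; 2. for all $a,x,y\in X$, the equality $x^p a=y^p a$ in $S$ implies $x=y$; 3. the monoid $S$ is (left and right) cancellative;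 4. the Gelfand–Kirillov dimension of $A$ is $n$; 5. $r$ is involutive, that is, $r^2=\mathrm{id}_{X\times X}$. Call a monoid $M$ with a map $R(u,v)=({}^uv,u^v)$ on $M\times M$ a braided monoid if ${}^a1=1$, ${}^1u=u$, $1^u=1$, $a^1=a$, ${}^{ab}u={}^a({}^bu)$, $a^{uv}=(a^u)^v$, ${}^a(uv)=({}^au)({}^{a^u}v)$, $(ab)^u=(a^{{}^bu})(b^u)$ and ${}^uv\cdot u^v=uv$ for all $a,b,u,v\in M$, and $R$ is bijective and satisfies the braid relation; if $M$ is a group, $(M,R)$ is called a braided group. If condition 5 holds, then the following is true as well. There is exactly one map $r_S$ on $S\times S$ such that $(S,r_S)$ is a braided monoid and $r_S$ agrees with $r$ on the generators, and exactly one map $r_G$ on $G\times G$ such that $(G,r_G)$ is a braided group and $r_G$ agrees with $r$ on the images of the generators in $G$. The canonical homomorphism $S\to G$ is injective and carries $r_S$ to $r_G$. Both $(S,r_S)$ and $(G,r_G)$ are non-degenerate involutive solutions of the Yang–Baxter equation. -/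

import Mathlib

namespace BraidedSet

/-- The left action `ᵘv` read off a map `r (u, v) = (ᵘv, uᵛ)`; `leftAct r u` is `𝓛_u`. -/
def leftAct {X : Type*} (r : X × X → X × X) (u : X) : X → X := fun v => (r (u, v)).1

/-- The right action `uᵛ` read off a map `r (u, v) = (ᵘv, uᵛ)`; `rightAct r v` is `𝓡_v`. -/
def rightAct {X : Type*} (r : X × X → X × X) (v : X) : X → X := fun u => (r (u, v)).2

/-- `r × id` on `X × X × X`. -/
def r12 {X : Type*} (r : X × X → X × X) : X × X × X → X × X × X :=
  fun t => ((r (t.1, t.2.1)).1, (r (t.1, t.2.1)).2, t.2.2)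

/-- `id × r` on `X × X × X`. -/
def r23 {X : Type*} (r : X × X → X × X) : X × X × X → X × X × X :=
  fun t => (t.1, r t.2)

/-- `(X, r)` is a braided set: `r` is bijective and satisfies the braid relation. -/
structure IsBraidedSet {X : Type*} (r : X × X → X × X) : Prop where
  bijective : Function.Bijective r
  braid : r12 r ∘ r23 r ∘ r12 r = r23 r ∘ r12 r ∘ r23 r

/-- All the maps `𝓛_x` and `𝓡_x` are bijective. -/
def IsNonDegenerate {X : Type*} (r : X × X → X × X) : Prop :=
  ∀ x, Function.Bijective (leftAct r x) ∧ Function.Bijective (rightAct r x)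

/-- `r (x, x) = (x, x)` for all `x`. -/
def IsSquareFree {X : Type*} (r : X × X → X × X) : Prop := ∀ x, r (x, x) = (x, x)

/-- The defining relations `x y = y' x'` of the monoid: `r (x, y) = (y', x') ≠ (x, y)`. -/
inductive MonRel {X : Type*} (r : X × X → X × X) : FreeMonoid X → FreeMonoid X → Prop
  | mk (x y : X) (h : r (x, y) ≠ (x, y)) :
      MonRel r (FreeMonoid.of x * FreeMonoid.of y)
        (FreeMonoid.of (r (x, y)).1 * FreeMonoid.of (r (x, y)).2)

/-- The monoid `S(X, r)`. -/
abbrev Mon {X : Type*} (r : X × X → X × X) : Type _ := PresentedMonoid (MonRel r)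

/-- The defining relators of the group. -/
def groupRels {X : Type*} (r : X × X → X × X) : Set (FreeGroup X) :=
  {w | ∃ x y : X, r (x, y) ≠ (x, y) ∧
    w = FreeGroup.of x * FreeGroup.of y *
      (FreeGroup.of (r (x, y)).1 * FreeGroup.of (r (x, y)).2)⁻¹}

/-- The group `G(X, r)`. -/
abbrev Grp {X : Type*} (r : X × X → X × X) : Type _ := PresentedGroup (groupRels r)

/-- The defining relations of the algebra. -/
inductive AlgRel (k : Type*) [Field k] {X : Type*} (r : X × X → X × X) :
    FreeAlgebra k X → FreeAlgebra k X → Prop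
  | mk (x y : X) (h : r (x, y) ≠ (x, y)) :
      AlgRel k r (FreeAlgebra.ι k x * FreeAlgebra.ι k y)
        (FreeAlgebra.ι k (r (x, y)).1 * FreeAlgebra.ι k (r (x, y)).2)

/-- The quadratic algebra `A(k, X, r)`. -/
abbrev Alg (k : Type*) [Field k] {X : Type*} (r : X × X → X × X) : Type _ :=
  RingQuot (AlgRel k r)

/-- The image in `S(X, r)` of a generator. -/
def monOf {X : Type*} (r : X × X → X × X) (x : X) : Mon r := PresentedMonoid.of (MonRel r) x

/-- The image in `G(X, r)` of a generator. -/
def grpOf {X : Type*} (r : X × X → X × X) (x : X) : Grp r := PresentedGroup.of x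

theorem grpOf_mul {X : Type*} (r : X × X → X × X) (x y : X) (h : r (x, y) ≠ (x, y)) :
    grpOf r x * grpOf r y = grpOf r (r (x, y)).1 * grpOf r (r (x, y)).2 := by
  have h1 : PresentedGroup.mk (groupRels r) (FreeGroup.of x * FreeGroup.of y *
      (FreeGroup.of (r (x, y)).1 * FreeGroup.of (r (x, y)).2)⁻¹) = 1 :=
    PresentedGroup.one_of_mem ⟨x, y, h, rfl⟩
  rw [map_mul, map_inv, mul_inv_eq_one, map_mul, map_mul] at h1
  exact h1

/-- The canonical monoid homomorphism `S(X, r) → G(X, r)` that sends `x` to `x`. -/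
def monToGrp {X : Type*} (r : X × X → X × X) : Mon r →* Grp r :=
  PresentedMonoid.lift (grpOf r) (by
    rintro _ _ ⟨x, y, h⟩
    simpa using grpOf_mul r x y h)

theorem monToGrp_of {X : Type*} (r : X × X → X × X) (x : X) :
    monToGrp r (monOf r x) = grpOf r x := by
  simp [monToGrp, monOf]

/-- `𝓛_x` as an element of the monoid of self-maps of `X` under composition. -/
def leftEnd {X : Type*} (r : X × X → X × X) (x : X) : Function.End X := leftAct r x

/-- `𝓡_x` as an element of the monoid of self-maps of `X` under composition. -/
def rightEnd {X : Type*} (r : X × X → X × X) (x : X) : Function.End X := rightAct r x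

/-- The least common multiple of the orders of all the maps `𝓛_x` and `𝓡_x`. -/
noncomputable def actionLcm {X : Type*} [Fintype X] (r : X × X → X × X) : ℕ :=
  Finset.univ.lcm fun x : X =>
    Nat.lcm (orderOf (leftEnd r x)) (orderOf (rightEnd r x))

/-- The Gelfand–Kirillov dimension of a `k`-algebra: the supremum, over the finite-dimensional
subspaces `V`, of `limsup log (dim (k + V + V² + ⋯ + Vᵐ)) / log m` as `m → ∞`. -/
noncomputable def gkDim (k A : Type*) [Field k] [Ring A] [Algebra k A] : EReal :=
  ⨆ V : {V : Submodule k A // V.FG},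
    Filter.limsup (fun m : ℕ =>
      ((Real.log (Module.finrank k (∑ i ∈ Finset.range (m + 1), V.1 ^ i : Submodule k A)) /
        Real.log m : ℝ) : EReal)) Filter.atTop

/-- `(M, R)` is a braided monoid: the components of `R (u, v) = (ᵘv, uᵛ)` are a left and a right
action that make `(M, M)` a matched pair of monoids, `ᵘv uᵛ = u v` holds, and `R` is bijective and
satisfies the braid relation. For a group `M` this says that `(M, R)` is a braided group. -/
structure IsBraidedMonoid (M : Type*) [Monoid M] (R : M × M → M × M) : Prop where
  left_one : ∀ a, leftAct R a 1 = 1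
  one_left : ∀ u, leftAct R 1 u = u
  one_right : ∀ u, rightAct R u 1 = 1
  right_one : ∀ a, rightAct R 1 a = a
  mul_left : ∀ a b u, leftAct R (a * b) u = leftAct R a (leftAct R b u)
  right_mul : ∀ a u v, rightAct R (u * v) a = rightAct R v (rightAct R u a)
  left_mul : ∀ a u v,
    leftAct R a (u * v) = leftAct R a u * leftAct R (rightAct R u a) v
  mul_right : ∀ a b u,
    rightAct R u (a * b) = rightAct R (leftAct R b u) a * rightAct R u b
  compat : ∀ u v, leftAct R u v * rightAct R v u = u * v
  braided : IsBraidedSet R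

/-- `R` makes `M` a braided monoid and extends `r` along `ι : X → M`. -/
def IsBraidedExtension {X M : Type*} [Monoid M] (r : X × X → X × X) (ι : X → M)
    (R : M × M → M × M) : Prop :=
  IsBraidedMonoid M R ∧ ∀ x y, R (ι x, ι y) = (ι (r (x, y)).1, ι (r (x, y)).2)

end BraidedSet

/-! The proof is governed by the derived operation `u ↦ ᵛ(uᵛ)`. By the braid relation and
square-freeness, `derived r (ᵘz) u` is the first component of `r² (u, z)`, and `r` is involutive
exactly when `derived r v u = u` throughout (`involutive_iff_derived`).

Cancellation: `p`-th powers pass through generators, `a xᵖ = (ᵃx)ᵖ a` and `xᵖ a = a (xᵃ)ᵖ`, whence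
`xᵖ a = (derived r a x)ᵖ a`. So either weak cancellation law makes the derived operation trivial.
Conversely full cancellation gives both laws, because `xᵖ` determines `x`.

Growth: the operators `sweep x : s ↦ s · (s⁻¹ x)` on `S` satisfy `u v = v · derived v u`, and every
element of `S` is the value at `1` of a word in them. Such words can be sorted, so at most `(m +
1)ⁿ` elements have length at most `m`. If some `derived r z x ≠ x`, least words cannot contain both
`z` and many copies of `x`; one power of `m` is lost and the dimension is at most `n - 1`.

Involutive case: the sweeps commute and `x ↦ (e_x, 𝓛_x)` defines a homomorphism `S → ℤ^X ⋊ Sym X`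
whose first component is an injective cocycle (`isCocycle_monToWreath`). Hence `S` is cancellative
and grows like `ℕ^X`. Since powers pass through words, `G` consists of left fractions of `S`, and
the cocycle stays injective on `G` (`isCocycle_grpToWreath`). An injective cocycle with stable range
in an abelian group carries a braiding (`IsCocycle.isBraidedMonoid`); its uniqueness follows by
induction on words. -/

namespace BraidedSet

/-! ### Identities for square-free solutions and the derived operation. -/

section Identities

variable {X : Type*} {r : X × X → X × X}

theorem leftAct_leftAct (hb : IsBraidedSet r) (x y z : X) :
    leftAct r x (leftAct r y z) =
      leftAct r (leftAct r x y) (leftAct r (rightAct r y x) z) :=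
  (congrArg Prod.fst (congrFun hb.braid (x, y, z))).symm

theorem rightAct_rightAct (hb : IsBraidedSet r) (x y z : X) :
    rightAct r z (rightAct r y x) =
      rightAct r (rightAct r z y) (rightAct r (leftAct r y z) x) :=
  congrArg (fun t => t.2.2) (congrFun hb.braid (x, y, z))

theorem rightAct_leftAct (hb : IsBraidedSet r) (x y z : X) :
    rightAct r (leftAct r (rightAct r y x) z) (leftAct r x y) =
      leftAct r (rightAct r (leftAct r y z) x) (rightAct r z y) :=
  congrArg (fun t => t.2.1) (congrFun hb.braid (x, y, z))

theorem leftAct_self (hs : IsSquareFree r) (x : X) : leftAct r x x = x :=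
  congrArg Prod.fst (hs x)

theorem rightAct_self (hs : IsSquareFree r) (x : X) : rightAct r x x = x :=
  congrArg Prod.snd (hs x)

/-- In the braid relation at `(a, x, x)`, square-freeness turns both sides into values of the
injective map `𝓛` at `ᵃx`. -/
theorem leftAct_rightAct_self (hb : IsBraidedSet r) (hn : IsNonDegenerate r)
    (hs : IsSquareFree r) (a x : X) : leftAct r (rightAct r x a) x = leftAct r a x := by
  apply (hn (leftAct r a x)).1.1
  rw [← leftAct_leftAct hb, leftAct_self hs, leftAct_self hs]

theorem rightAct_leftAct_self (hb : IsBraidedSet r) (hn : IsNonDegenerate r)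
    (hs : IsSquareFree r) (x a : X) : rightAct r (leftAct r x a) x = rightAct r a x := by
  apply (hn (rightAct r a x)).2.1
  rw [← rightAct_rightAct hb, rightAct_self hs, rightAct_self hs]

/-- The map `u ↦ ᵛ(uᵛ)`, the operation of the derived solution of `(X, r)`. -/
def derived (r : X × X → X × X) (v u : X) : X := leftAct r v (rightAct r v u)

/-- Invariance of the derived operation under the action of `S`; it makes the relations between
sweeps independent of the element they act on. -/
theorem leftAct_derived (hb : IsBraidedSet r) (hn : IsNonDegenerate r) (hs : IsSquareFree r)
    (a v u : X) :
    leftAct r a (derived r v u) = derived r (leftAct r a v) (leftAct r a u) := by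
  obtain ⟨z, rfl⟩ := (hn u).1.2 v
  have h : rightAct r (leftAct r a (leftAct r u z)) (leftAct r a u) =
      leftAct r (rightAct r (leftAct r u z) a) (rightAct r z u) := by
    rw [leftAct_leftAct hb, rightAct_leftAct_self hb hn hs, rightAct_leftAct hb]
  rw [derived, derived, h, ← leftAct_leftAct hb, rightAct_leftAct_self hb hn hs]

theorem derived_bijective (hn : IsNonDegenerate r) (v : X) :
    Function.Bijective (derived r v) :=
  (hn v).1.comp (hn v).2

/-- For `v = ᵘz` one has `uᵛ = uᶻ`, so `derived r v u` is the first component of `r² (u, z)`. The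
second component then follows because `𝓡_a` inverts `𝓛_a`. -/
theorem involutive_iff_derived (hb : IsBraidedSet r) (hn : IsNonDegenerate r)
    (hs : IsSquareFree r) : Function.Involutive r ↔ ∀ v u, derived r v u = u := by
  constructor
  · intro h v u
    obtain ⟨z, rfl⟩ := (hn u).1.2 v
    rw [derived, rightAct_leftAct_self hb hn hs]
    exact congrArg Prod.fst (h (u, z))
  · rintro h ⟨x, y⟩
    have h1 : leftAct r (leftAct r x y) (rightAct r y x) = x := by
      rw [← rightAct_leftAct_self hb hn hs]
      exact h _ _
    have h2 : ∀ a y, rightAct r a (leftAct r a y) = y := fun a y => (hn a).1.1 (h a _)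
    refine Prod.ext h1 ?_
    change rightAct r (rightAct r y x) (leftAct r x y) = y
    rw [← rightAct_leftAct_self hb hn hs, h1, h2]

end Identities

/-! ### Powers of generators and the cancellation conditions. -/

section Monoid

variable {X : Type*} {r : X × X → X × X}

theorem monOf_mul_monOf (r : X × X → X × X) (x y : X) :
    monOf r x * monOf r y = monOf r (leftAct r x y) * monOf r (rightAct r y x) := by
  by_cases h : r (x, y) = (x, y)
  · simp [leftAct, rightAct, h]
  · exact PresentedMonoid.mk_eq_mk_of_rel (MonRel.mk x y h)

theorem grpOf_mul_grpOf (r : X × X → X × X) (x y : X) :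
    grpOf r x * grpOf r y = grpOf r (leftAct r x y) * grpOf r (rightAct r y x) := by
  by_cases h : r (x, y) = (x, y)
  · simp [leftAct, rightAct, h]
  · exact grpOf_mul r x y h

/-- A homomorphism out of `S(X, r)` from images of the generators that satisfy the relations. -/
def monLift {M : Type*} [Monoid M] (f : X → M)
    (h : ∀ x y, f x * f y = f (leftAct r x y) * f (rightAct r y x)) : Mon r →* M :=
  PresentedMonoid.lift f (by
    rintro _ _ ⟨x, y, _⟩
    simpa [leftAct, rightAct] using h x y)

@[simp] theorem monLift_monOf {M : Type*} [Monoid M] (f : X → M)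
    (h : ∀ x y, f x * f y = f (leftAct r x y) * f (rightAct r y x)) (x : X) :
    monLift f h (monOf r x) = f x := by
  simp [monLift, monOf]

/-- A homomorphism out of `G(X, r)` from images of the generators that satisfy the relations. -/
def grpLift {M : Type*} [Group M] (f : X → M)
    (h : ∀ x y, f x * f y = f (leftAct r x y) * f (rightAct r y x)) : Grp r →* M :=
  PresentedGroup.toGroup (f := f) (by
    rintro _ ⟨x, y, _, rfl⟩
    simpa [mul_inv_eq_one, -mul_inv_rev, leftAct, rightAct] using h x y)

@[simp] theorem grpLift_grpOf {M : Type*} [Group M] (f : X → M)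
    (h : ∀ x y, f x * f y = f (leftAct r x y) * f (rightAct r y x)) (x : X) :
    grpLift f h (grpOf r x) = f x :=
  PresentedGroup.toGroup.of _

@[elab_as_elim]
theorem mon_induction {P : Mon r → Prop} (one : P 1)
    (mul : ∀ s x, P s → P (s * monOf r x)) (s : Mon r) : P s := by
  have hs : s ∈ Submonoid.closure (Set.range (PresentedMonoid.of (MonRel r))) := by
    rw [PresentedMonoid.closure_range_of]; trivial
  induction hs using Submonoid.closure_induction_right with
  | one => exact one
  | mul_right s _ y hy ih => obtain ⟨x, rfl⟩ := hy; exact mul s x ih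

@[elab_as_elim]
theorem grp_induction {P : Grp r → Prop} (one : P 1)
    (mul : ∀ g x, P g → P (g * grpOf r x)) (mul_inv : ∀ g x, P g → P (g * (grpOf r x)⁻¹))
    (g : Grp r) : P g := by
  have hg : g ∈ Subgroup.closure (Set.range (PresentedGroup.of (rels := groupRels r))) := by
    rw [PresentedGroup.closure_range_of]; trivial
  induction hg using Subgroup.closure_induction_right with
  | one => exact one
  | mul_right s _ y hy ih => obtain ⟨x, rfl⟩ := hy; exact mul s x ih
  | mul_inv_cancel s _ y hy ih => obtain ⟨x, rfl⟩ := hy; exact mul_inv s x ih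

/-- Passing one `x` changes `a` into `aˣ`, but `aˣ` and `a` act alike on `x`, so each further `x`
becomes the same generator. -/
theorem monOf_mul_pow (hb : IsBraidedSet r) (hn : IsNonDegenerate r) (hs : IsSquareFree r)
    (a x : X) (k : ℕ) :
    monOf r a * monOf r x ^ k = monOf r (leftAct r a x) ^ k * monOf r ((rightAct r x)^[k] a) := by
  induction k generalizing a with
  | zero => simp
  | succ k ih =>
    rw [pow_succ', ← mul_assoc, monOf_mul_monOf, mul_assoc, ih, leftAct_rightAct_self hb hn hs,
      ← mul_assoc, ← pow_succ', Function.iterate_succ_apply]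

theorem monOf_pow_mul (hb : IsBraidedSet r) (hn : IsNonDegenerate r) (hs : IsSquareFree r)
    (a x : X) (k : ℕ) :
    monOf r x ^ k * monOf r a = monOf r ((leftAct r x)^[k] a) * monOf r (rightAct r a x) ^ k := by
  induction k generalizing a with
  | zero => simp
  | succ k ih =>
    rw [pow_succ, mul_assoc, monOf_mul_monOf, ← mul_assoc, ih, rightAct_leftAct_self hb hn hs,
      mul_assoc, ← pow_succ, Function.iterate_succ_apply]

theorem iterate_eq_of_dvd {f : Function.End X} {k : ℕ} (h : orderOf f ∣ k) (a : X) :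
    Nat.iterate (α := X) f k a = a := by
  have key : ∀ k : ℕ, ∀ a, Nat.iterate (α := X) f k a = (f ^ k : Function.End X) a := by
    intro k
    induction k with
    | zero => exact fun _ => rfl
    | succ k ih =>
      intro a
      rw [pow_succ]
      exact ih (f a)
  rw [key, orderOf_dvd_iff_pow_eq_one.1 h]
  rfl

theorem iterate_leftAct_actionLcm [Fintype X] (r : X × X → X × X) (x a : X) :
    (leftAct r x)^[actionLcm r] a = a := by
  have h : orderOf (leftEnd r x) ∣ actionLcm r :=
    (Nat.dvd_lcm_left _ _).trans (Finset.dvd_lcm (Finset.mem_univ x))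
  exact iterate_eq_of_dvd h a

theorem iterate_rightAct_actionLcm [Fintype X] (r : X × X → X × X) (x a : X) :
    (rightAct r x)^[actionLcm r] a = a := by
  have h : orderOf (rightEnd r x) ∣ actionLcm r :=
    (Nat.dvd_lcm_right _ _).trans (Finset.dvd_lcm (Finset.mem_univ x))
  exact iterate_eq_of_dvd h a

theorem orderOf_end_pos [Finite X] {f : Function.End X} (h : Function.Bijective f) :
    0 < orderOf f := by
  rw [orderOf_pos_iff]
  exact MonoidHom.isOfFinOrder
    ((Units.coeHom (Function.End X)).comp Equiv.Perm.equivUnitsEnd.toMonoidHom)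
    (isOfFinOrder_of_finite (Equiv.ofBijective f h))

/-- `orderOf` is `0` on elements of infinite order; bijectivity on a finite set excludes this value.
-/
theorem actionLcm_pos [Fintype X] (hn : IsNonDegenerate r) : 0 < actionLcm r := by
  rw [Nat.pos_iff_ne_zero, actionLcm, Ne, Finset.lcm_eq_zero_iff]
  rintro ⟨x, -, hx⟩
  exact (Nat.lcm_pos (orderOf_end_pos (hn x).1) (orderOf_end_pos (hn x).2)).ne' hx

theorem monOf_mul_pow_actionLcm [Fintype X] (hb : IsBraidedSet r) (hn : IsNonDegenerate r)
    (hs : IsSquareFree r) (a x : X) :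
    monOf r a * monOf r x ^ actionLcm r = monOf r (leftAct r a x) ^ actionLcm r * monOf r a := by
  rw [monOf_mul_pow hb hn hs, iterate_rightAct_actionLcm]

theorem monOf_pow_actionLcm_mul [Fintype X] (hb : IsBraidedSet r) (hn : IsNonDegenerate r)
    (hs : IsSquareFree r) (a x : X) :
    monOf r x ^ actionLcm r * monOf r a = monOf r a * monOf r (rightAct r a x) ^ actionLcm r := by
  rw [monOf_pow_mul hb hn hs, iterate_leftAct_actionLcm]

theorem involutive_of_mul_pow [Fintype X] (hb : IsBraidedSet r) (hn : IsNonDegenerate r)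
    (hs : IsSquareFree r)
    (h : ∀ a x y : X, monOf r a * monOf r x ^ actionLcm r = monOf r a * monOf r y ^ actionLcm r →
      x = y) : Function.Involutive r := by
  refine (involutive_iff_derived hb hn hs).2 fun a x => ?_
  obtain ⟨y, rfl⟩ := (hn a).1.2 x
  -- Both `a yᵖ` and `a ((ᵃy)ᵃ)ᵖ` equal `(ᵃy)ᵖ a`, so the hypothesis gives `y = (ᵃy)ᵃ`.
  refine congrArg (leftAct r a) (h a y _ ?_).symm
  rw [monOf_mul_pow_actionLcm hb hn hs, monOf_pow_actionLcm_mul hb hn hs]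

theorem involutive_of_pow_mul [Fintype X] (hb : IsBraidedSet r) (hn : IsNonDegenerate r)
    (hs : IsSquareFree r)
    (h : ∀ a x y : X, monOf r x ^ actionLcm r * monOf r a = monOf r y ^ actionLcm r * monOf r a →
      x = y) : Function.Involutive r := by
  refine (involutive_iff_derived hb hn hs).2 fun a x => (h a x _ ?_).symm
  rw [monOf_pow_actionLcm_mul hb hn hs, monOf_mul_pow_actionLcm hb hn hs, derived]

/-- The indicator of words in `x` alone is a homomorphism to multiplicative `ℕ`, because `(x, x)` is
the only preimage of `(x, x)` under `r`. -/
theorem eq_of_monOf_pow_eq (hb : IsBraidedSet r) (hs : IsSquareFree r) {x y : X} {k : ℕ}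
    (hk : k ≠ 0) (h : monOf r x ^ k = monOf r y ^ k) : x = y := by
  classical
  have key : ∀ u v : X, leftAct r u v = x ∧ rightAct r v u = x ↔ u = x ∧ v = x := by
    intro u v
    rw [← Prod.mk.injEq, ← Prod.mk.injEq]
    constructor
    · intro e
      exact hb.bijective.1 (e.trans (hs x).symm)
    · intro e
      rw [Prod.mk.injEq] at e
      rw [e.1, e.2, leftAct_self hs, rightAct_self hs]
  let f : Mon r →* ℕ := monLift (fun u => if u = x then 1 else 0) fun u v => by
    simp only [mul_ite, mul_zero, mul_one, ← ite_and, and_comm (a := v = x),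
      and_comm (a := rightAct r v u = x), key]
  by_contra hne
  have := congrArg f h
  simp [f, hk, Ne.symm hne] at this

end Monoid

/-! ### Counting products under the relations `F u * F v = F v * F (τ v u)`. -/

section SortedProducts

variable {X M : Type*}

/-- A sorted list is determined by its letter counts. -/
theorem exists_finset_sorted_lists [Fintype X] [LinearOrder X] (c : X → ℕ) :
    ∃ T : Finset (List X), T.card ≤ ∏ y, c y ∧
      ∀ l : List X, l.Pairwise (· ≤ ·) → (∀ y, l.count y < c y) → l ∈ T := by
  let S : Set (List X) := {l | l.Pairwise (· ≤ ·) ∧ ∀ y, l.count y < c y}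
  let φ : List X → X → ℕ := fun l y => l.count y
  let P : Finset (X → ℕ) := Fintype.piFinset fun y => Finset.range (c y)
  have hmaps : Set.MapsTo φ S P := fun l hl => by
    simpa [P, φ] using hl.2
  have hinj : Set.InjOn φ S := fun l hl l' hl' e =>
    (List.perm_iff_count.2 fun y => congrFun e y).eq_of_pairwise
      (fun _ _ _ _ h h' => le_antisymm h h') hl.1 hl'.1
  have hfin : S.Finite := Set.Finite.of_injOn hmaps hinj P.finite_toSet
  refine ⟨hfin.toFinset, ?_, fun l h h' => by simpa [S] using ⟨h, h'⟩⟩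
  calc hfin.toFinset.card ≤ P.card :=
        Finset.card_le_card_of_injOn φ (by simpa using hmaps) (by simpa using hinj)
    _ = ∏ y, c y := by simp [P]

theorem append_lt_append_of_head_lt [LinearOrder X] {l l₁ l₂ : List X} {u v : X} (h : v < u) :
    l ++ v :: l₁ < l ++ u :: l₂ :=
  List.append_left_lt (List.cons_lt_cons_iff.2 (Or.inl h))

variable [Monoid M] {F : X → M} {τ : X → X → X}

/-- Among the words with a given product there is a lexicographically least one. -/
theorem exists_least_word [Finite X] [LinearOrder X] (F : X → M)
    (l : List X) :
    ∃ l' : List X, l'.length = l.length ∧ (l'.map F).prod = (l.map F).prod ∧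
      ∀ l'' : List X, l''.length = l'.length → (l''.map F).prod = (l'.map F).prod →
        ¬ l'' < l' := by
  let S : Set (List X) := {l' | l'.length = l.length ∧ (l'.map F).prod = (l.map F).prod}
  have hfin : S.Finite := (List.finite_length_eq X l.length).subset fun _ h => h.1
  obtain ⟨l', hl', hmin⟩ := Set.exists_min_image S id hfin ⟨l, rfl, rfl⟩
  exact ⟨l', hl'.1, hl'.2, fun l'' h h' => not_lt.2 (hmin l'' ⟨h.trans hl'.1, h'.trans hl'.2⟩)⟩

/-- A descent `u, v` could be replaced by `v, τ v u`, which is lexicographically smaller whatever `τ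
v u` is. -/
theorem pairwise_le_of_least [LinearOrder X] (hF : ∀ u v, F u * F v = F v * F (τ v u)) {l : List X}
    (hl : ∀ l' : List X, l'.length = l.length → (l'.map F).prod = (l.map F).prod → ¬ l' < l) :
    l.Pairwise (· ≤ ·) := by
  rw [← List.isChain_iff_pairwise, List.isChain_iff_forall_rel_of_append_cons_cons]
  intro u v l₁ l₂ e
  by_contra h
  subst e
  refine hl (l₁ ++ v :: τ v u :: l₂) (by simp) ?_ (append_lt_append_of_head_lt (not_le.1 h))
  simp only [List.map_append, List.map_cons, List.prod_append, List.prod_cons]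
  rw [← mul_assoc (F v), ← hF, mul_assoc]

theorem exists_finset_prod [Fintype X] [LinearOrder X]
    (hF : ∀ u v, F u * F v = F v * F (τ v u)) (m : ℕ) :
    ∃ T : Finset M, T.card ≤ (m + 1) ^ Fintype.card X ∧
      ∀ l : List X, l.length ≤ m → (l.map F).prod ∈ T := by
  classical
  obtain ⟨T, hT, hmem⟩ := exists_finset_sorted_lists fun _ : X => m + 1
  refine ⟨T.image fun l => (l.map F).prod, Finset.card_image_le.trans (by simpa using hT), ?_⟩
  intro l hl
  obtain ⟨l', hlen, hprod, hmin⟩ := exists_least_word F l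
  rw [← hprod]
  refine Finset.mem_image_of_mem _ (hmem _ (pairwise_le_of_least hF hmin) fun y => ?_)
  have := l'.count_le_length (a := y)
  omega

theorem mul_pow_eq_pow_mul_iterate (hF : ∀ u v, F u * F v = F v * F (τ v u)) (u v : X) (k : ℕ) :
    F u * F v ^ k = F v ^ k * F ((τ v)^[k] u) := by
  induction k generalizing u with
  | zero => simp
  | succ k ih =>
    rw [pow_succ', ← mul_assoc, hF, mul_assoc, ih, ← mul_assoc, Function.iterate_succ_apply]

theorem pow_mul_eq_mul_pow (hF : ∀ u v, F u * F v = F v * F (τ v u)) (u v : X) (k : ℕ) :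
    F u ^ k * F v = F v * F (τ v u) ^ k := by
  induction k with
  | zero => simp
  | succ k ih => rw [pow_succ, mul_assoc, hF, ← mul_assoc, ih, mul_assoc, ← pow_succ]

theorem eq_append_replicate_of_le_count [LinearOrder X] {l : List X}
    (hl : l.Pairwise (· ≤ ·)) {x : X} (hx : ∀ y, y ≤ x) {q : ℕ} (hq : q ≤ l.count x) :
    ∃ l', l = l' ++ List.replicate q x := by
  have hperm : List.Perm l (l.filter (· ≠ x) ++ List.replicate (l.count x) x) := by
    rw [List.perm_iff_count]
    intro y
    by_cases h : y = x
    · subst h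
      simp [List.count_eq_zero]
    · simp [List.count_replicate, List.count_filter, h, Ne.symm h]
  have h2 : (l.filter (· ≠ x) ++ List.replicate (l.count x) x).Pairwise (· ≤ ·) := by
    rw [List.pairwise_append]
    refine ⟨hl.filter _, List.pairwise_replicate.2 (Or.inr le_rfl), fun a _ b hb => ?_⟩
    rw [List.eq_of_mem_replicate hb]
    exact hx a
  refine ⟨l.filter (· ≠ x) ++ List.replicate (l.count x - q) x, ?_⟩
  rw [List.append_assoc, List.replicate_append_replicate, Nat.sub_add_cancel hq]
  exact hperm.eq_of_pairwise (fun _ _ _ _ h h' => le_antisymm h h') hl h2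

/-- Each `F y ^ q` commutes with all products, so `z xᵠ = xᵠ z = z (τ z x)ᵠ`. A sorted word
containing `z` and ending in `xᵠ` could therefore trade these copies of the largest letter for
copies of the smaller `τ z x`. -/
theorem count_lt_or_count_eq_zero_of_least [LinearOrder X]
    (hF : ∀ u v, F u * F v = F v * F (τ v u)) {q : ℕ}
    (hq : 0 < q) (hτ : ∀ v u, (τ v)^[q] u = u) {x z : X} (hx : ∀ y, y ≤ x) (hzx : z ≠ x)
    (hne : τ z x ≠ x) {l : List X}
    (hl : ∀ l' : List X, l'.length = l.length → (l'.map F).prod = (l.map F).prod → ¬ l' < l) :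
    l.count x < q ∨ l.count z = 0 := by
  by_contra! h
  obtain ⟨l', rfl⟩ := eq_append_replicate_of_le_count (pairwise_le_of_least hF hl) hx h.1
  have hz : z ∈ l' := by
    have := List.count_pos_iff.1 (Nat.pos_of_ne_zero h.2)
    rw [List.mem_append] at this
    exact this.resolve_right fun h => hzx (List.eq_of_mem_replicate h)
  obtain ⟨l₁, l₂, rfl⟩ := List.append_of_mem hz
  have hcomm : ∀ (y : X) (l : List X), Commute (l.map F).prod (F y ^ q) := by
    intro y l
    refine Commute.list_prod_left _ _ ?_
    simp only [List.mem_map, forall_exists_index, and_imp, forall_apply_eq_imp_iff₂]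
    intro u _
    exact (mul_pow_eq_pow_mul_iterate hF u y q).trans (by rw [hτ])
  refine hl ((l₁ ++ z :: l₂) ++ List.replicate q (τ z x)) (by simp) ?_ ?_
  · simp only [List.map_append, List.map_cons, List.prod_append, List.prod_cons,
      List.map_replicate, List.prod_replicate, mul_assoc]
    rw [(hcomm x l₂).eq, (hcomm _ l₂).eq, ← mul_assoc (F z), ← pow_mul_eq_mul_pow hF,
      ← mul_assoc (F z), ← mul_assoc]
    have : F z * F x ^ q = F x ^ q * F z := by simpa using (hcomm x [z]).eq
    rw [this]
    simp only [mul_assoc]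
  · obtain ⟨k, rfl⟩ := Nat.exists_eq_succ_of_ne_zero hq.ne'
    rw [List.replicate_succ, List.replicate_succ]
    exact append_lt_append_of_head_lt (lt_of_le_of_ne (hx _) hne)

/-- Least words either have fewer than `q` letters `x` or no letter `z`: one exponent has `q`
values, respectively one, which gives the factor `q + 1`. -/
theorem exists_finset_prod_of_ne [Fintype X] [LinearOrder X]
    (hF : ∀ u v, F u * F v = F v * F (τ v u)) {q : ℕ}
    (hq : 0 < q) (hτ : ∀ v u, (τ v)^[q] u = u) {x z : X} (hx : ∀ y, y ≤ x) (hzx : z ≠ x)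
    (hne : τ z x ≠ x) (m : ℕ) :
    ∃ T : Finset M, T.card ≤ (q + 1) * (m + 1) ^ (Fintype.card X - 1) ∧
      ∀ l : List X, l.length ≤ m → (l.map F).prod ∈ T := by
  classical
  have hc : ∀ (y : X) (j : ℕ), ∏ u, (if u = y then j else m + 1) =
      j * (m + 1) ^ (Fintype.card X - 1) := by
    intro y j
    rw [← Finset.mul_prod_erase _ _ (Finset.mem_univ y), if_pos rfl,
      Finset.prod_congr rfl fun u hu => if_neg (Finset.ne_of_mem_erase hu),
      Finset.prod_const, Finset.card_erase_of_mem (Finset.mem_univ y), Finset.card_univ]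
  obtain ⟨T₁, hT₁, hmem₁⟩ := exists_finset_sorted_lists fun y : X => if y = x then q else m + 1
  obtain ⟨T₂, hT₂, hmem₂⟩ := exists_finset_sorted_lists fun y : X => if y = z then 1 else m + 1
  rw [hc] at hT₁ hT₂
  refine ⟨(T₁ ∪ T₂).image fun l => (l.map F).prod, ?_, ?_⟩
  · refine Finset.card_image_le.trans ((Finset.card_union_le _ _).trans ?_)
    rw [add_mul]
    exact add_le_add hT₁ hT₂
  intro l hl
  obtain ⟨l', hlen, hprod, hmin⟩ := exists_least_word F l
  rw [← hprod]
  refine Finset.mem_image_of_mem _ (Finset.mem_union.2 ?_)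
  have hle : ∀ y, l'.count y < m + 1 := fun y => by
    have := l'.count_le_length (a := y)
    omega
  refine (count_lt_or_count_eq_zero_of_least hF hq hτ hx hzx hne hmin).imp (fun h => ?_)
    fun h => ?_
  · refine hmem₁ _ (pairwise_le_of_least hF hmin) fun y => ?_
    split_ifs with e
    · exact e ▸ h
    · exact hle y
  · refine hmem₂ _ (pairwise_le_of_least hF hmin) fun y => ?_
    split_ifs with e
    · rw [e, h]; exact one_pos
    · exact hle y

end SortedProducts

/-! ### Sweeps: from words in `S` to the derived relations. -/

section Sweep

theorem perm_inv_apply_self {X : Type*} (σ : Equiv.Perm X) (x : X) : σ⁻¹ (σ x) = x :=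
  σ.symm_apply_apply x

variable {X : Type*} {r : X × X → X × X}

/-- `𝓛_x` as a permutation. -/
noncomputable def leftPerm (hn : IsNonDegenerate r) (x : X) : Equiv.Perm X :=
  Equiv.ofBijective _ (hn x).1

@[simp] theorem leftPerm_apply (hn : IsNonDegenerate r) (x y : X) :
    leftPerm hn x y = leftAct r x y := rfl

theorem leftPerm_mul (hb : IsBraidedSet r) (hn : IsNonDegenerate r) (x y : X) :
    leftPerm hn x * leftPerm hn y = leftPerm hn (leftAct r x y) * leftPerm hn (rightAct r y x) :=
  Equiv.ext fun z => leftAct_leftAct hb x y z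

/-- The action of `S(X, r)` on `X` that extends `x ↦ 𝓛_x`. -/
noncomputable def monPerm (hb : IsBraidedSet r) (hn : IsNonDegenerate r) :
    Mon r →* Equiv.Perm X :=
  monLift (leftPerm hn) (leftPerm_mul hb hn)

@[simp] theorem monPerm_monOf (hb : IsBraidedSet r) (hn : IsNonDegenerate r) (x : X) :
    monPerm hb hn (monOf r x) = leftPerm hn x := monLift_monOf _ _ _

theorem monPerm_derived (hb : IsBraidedSet r) (hn : IsNonDegenerate r) (hs : IsSquareFree r)
    (s : Mon r) (v u : X) :
    monPerm hb hn s (derived r v u) = derived r (monPerm hb hn s v) (monPerm hb hn s u) := by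
  induction s using mon_induction generalizing u v with
  | one => simp
  | mul s x ih => simp [leftAct_derived hb hn hs, ih]

/-- Right multiplication of `s` by the generator that `s` carries to `x`. -/
noncomputable def sweep (hb : IsBraidedSet r) (hn : IsNonDegenerate r) (x : X) :
    (Function.End (Mon r))ᵐᵒᵖ :=
  MulOpposite.op fun s => s * monOf r ((monPerm hb hn s)⁻¹ x)

/-- With `u = s(a)` and `v = s(ᵃb)`, the left side sends `s` to `s a b` and the right side to `s
(ᵃb)(aᵇ)`. In the opposite monoid the leftmost factor acts first. -/
theorem sweep_mul_sweep (hb : IsBraidedSet r) (hn : IsNonDegenerate r) (hs : IsSquareFree r)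
    (u v : X) :
    sweep hb hn u * sweep hb hn v = sweep hb hn v * sweep hb hn (derived r v u) := by
  refine MulOpposite.unop_injective (funext fun s => ?_)
  change (s * monOf r ((monPerm hb hn s)⁻¹ u)) *
      monOf r ((monPerm hb hn (s * monOf r ((monPerm hb hn s)⁻¹ u)))⁻¹ v) =
    (s * monOf r ((monPerm hb hn s)⁻¹ v)) *
      monOf r ((monPerm hb hn (s * monOf r ((monPerm hb hn s)⁻¹ v)))⁻¹ (derived r v u))
  obtain ⟨a, rfl⟩ := (monPerm hb hn s).surjective u
  obtain ⟨v, rfl⟩ := (monPerm hb hn s).surjective v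
  obtain ⟨b, rfl⟩ := (leftPerm hn a).surjective v
  have h : derived r (leftAct r a b) a = leftPerm hn (leftAct r a b) (rightAct r b a) := by
    rw [derived, rightAct_leftAct_self hb hn hs, leftPerm_apply]
  rw [← monPerm_derived hb hn hs]
  simp only [map_mul, monPerm_monOf, mul_inv_rev, Equiv.Perm.mul_apply,
    perm_inv_apply_self, leftPerm_apply, h]
  rw [← leftPerm_apply hn a b, perm_inv_apply_self, ← leftPerm_apply hn (leftPerm hn a b),
    perm_inv_apply_self, mul_assoc, mul_assoc, monOf_mul_monOf]
  rfl

theorem sweep_append_apply (hb : IsBraidedSet r) (hn : IsNonDegenerate r) (l : List X) (y : X)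
    (s : Mon r) :
    (((l ++ [y]).map (sweep hb hn)).prod.unop : Mon r → Mon r) s =
      ((l.map (sweep hb hn)).prod.unop : Mon r → Mon r) s *
        monOf r ((monPerm hb hn (((l.map (sweep hb hn)).prod.unop : Mon r → Mon r) s))⁻¹ y) := by
  rw [List.map_append, List.prod_append, List.map_singleton, List.prod_singleton]
  rfl

theorem exists_sweep_eq (hb : IsBraidedSet r) (hn : IsNonDegenerate r) (w : List X) :
    ∃ l : List X, l.length = w.length ∧
      ((l.map (sweep hb hn)).prod.unop : Mon r → Mon r) 1 = (w.map (monOf r)).prod := by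
  induction w using List.reverseRecOn with
  | nil => exact ⟨[], rfl, rfl⟩
  | append_singleton w x ih =>
    obtain ⟨l, hl, e⟩ := ih
    -- The sweep label of the letter `x` is its image under the prefix before it.
    refine ⟨l ++ [monPerm hb hn (w.map (monOf r)).prod x], by simp [hl], ?_⟩
    rw [sweep_append_apply, e, perm_inv_apply_self, List.map_append, List.prod_append]
    simp

/-- The number of elements of `S(X, r)` of length at most `m`. -/
theorem exists_finset_mon [Fintype X] (hb : IsBraidedSet r) (hn : IsNonDegenerate r)
    (hs : IsSquareFree r) (m : ℕ) :
    ∃ T : Finset (Mon r), T.card ≤ (m + 1) ^ Fintype.card X ∧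
      ∀ w : List X, w.length ≤ m → (w.map (monOf r)).prod ∈ T := by
  classical
  let _ : LinearOrder X := LinearOrder.lift' (Fintype.equivFin X) (Fintype.equivFin X).injective
  obtain ⟨T, hT, hmem⟩ := exists_finset_prod (sweep_mul_sweep hb hn hs) m
  refine ⟨T.image fun f => (f.unop : Mon r → Mon r) 1, Finset.card_image_le.trans hT,
    fun w hw => ?_⟩
  obtain ⟨l, hl, e⟩ := exists_sweep_eq hb hn w
  rw [← e]
  exact Finset.mem_image_of_mem (fun f => (f.unop : Mon r → Mon r) 1) (hmem l (hl.trans_le hw))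

/-- If `r` is not involutive, the growth of `S(X, r)` is smaller. -/
theorem exists_finset_mon_of_not_involutive [Fintype X] (hb : IsBraidedSet r)
    (hn : IsNonDegenerate r) (hs : IsSquareFree r) (hr : ¬ Function.Involutive r) :
    ∃ C : ℕ, ∀ m : ℕ, ∃ T : Finset (Mon r), T.card ≤ C * (m + 1) ^ (Fintype.card X - 1) ∧
      ∀ w : List X, w.length ≤ m → (w.map (monOf r)).prod ∈ T := by
  classical
  rw [involutive_iff_derived hb hn hs] at hr
  push Not at hr
  obtain ⟨z, x, hne⟩ := hr
  have hzx : z ≠ x := by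
    rintro rfl
    exact hne (by rw [derived, rightAct_self hs, leftAct_self hs])
  -- An order in which `x` is the largest letter, as the sharper count requires.
  let e : X → ℕ := fun y => if y = x then Fintype.card X else Fintype.equivFin X y
  have he : Function.Injective e := by
    intro y y' h
    have h1 := (Fintype.equivFin X y).isLt
    have h2 := (Fintype.equivFin X y').isLt
    simp only [e] at h
    split_ifs at h with h3 h4 h4
    · exact h3.trans h4.symm
    · omega
    · omega
    · exact (Fintype.equivFin X).injective (Fin.ext h)
  let _ : LinearOrder X := LinearOrder.lift' e he
  have hx : ∀ y, y ≤ x := by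
    intro y
    change e y ≤ e x
    have h1 := (Fintype.equivFin X y).isLt
    simp only [e]
    split_ifs <;> omega
  let τ : X → Equiv.Perm X := fun v => Equiv.ofBijective _ (derived_bijective hn v)
  refine ⟨Monoid.exponent (Equiv.Perm X) + 1, fun m => ?_⟩
  have hq : 0 < Monoid.exponent (Equiv.Perm X) := Monoid.ExponentExists.of_finite.exponent_pos
  have hτ : ∀ v u, (derived r v)^[Monoid.exponent (Equiv.Perm X)] u = u := fun v u => by
    have : (⇑(τ v))^[Monoid.exponent (Equiv.Perm X)] u = u := by
      rw [Equiv.Perm.iterate_eq_pow, Monoid.pow_exponent_eq_one]; rfl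
    exact this
  obtain ⟨T, hT, hmem⟩ :=
    exists_finset_prod_of_ne (sweep_mul_sweep hb hn hs) hq hτ hx hzx hne m
  refine ⟨T.image fun f => (f.unop : Mon r → Mon r) 1, Finset.card_image_le.trans hT,
    fun w hw => ?_⟩
  obtain ⟨l, hl, e⟩ := exists_sweep_eq hb hn w
  rw [← e]
  exact Finset.mem_image_of_mem (fun f => (f.unop : Mon r → Mon r) 1) (hmem l (hl.trans_le hw))

end Sweep

/-! ### Braided monoids: the braid relation and uniqueness of extensions. -/

section BraidedMonoids

variable {M : Type*}

/-- The action laws give the outer components of the braid relation; both triples have product `a b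
c`, so cancellation gives the middle one. -/
theorem isBraidedSet_of_axioms [Monoid M] [IsCancelMul M] {R : M × M → M × M}
    (hR : Function.Bijective R)
    (mul_left : ∀ a b u, leftAct R (a * b) u = leftAct R a (leftAct R b u))
    (right_mul : ∀ a u v, rightAct R (u * v) a = rightAct R v (rightAct R u a))
    (compat : ∀ u v, leftAct R u v * rightAct R v u = u * v) : IsBraidedSet R := by
  refine ⟨hR, funext ?_⟩
  rintro ⟨a, b, c⟩
  have h1 : leftAct R (leftAct R a b) (leftAct R (rightAct R b a) c) =
      leftAct R a (leftAct R b c) := by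
    rw [← mul_left, compat, mul_left]
  have h3 : rightAct R c (rightAct R b a) =
      rightAct R (rightAct R c b) (rightAct R (leftAct R b c) a) := by
    rw [← right_mul, ← right_mul, compat]
  have hL : leftAct R (leftAct R a b) (leftAct R (rightAct R b a) c) *
      rightAct R (leftAct R (rightAct R b a) c) (leftAct R a b) *
      rightAct R c (rightAct R b a) = a * b * c := by
    rw [compat, mul_assoc, compat, ← mul_assoc, compat]
  have hR : leftAct R a (leftAct R b c) *
      leftAct R (rightAct R (leftAct R b c) a) (rightAct R c b) *
      rightAct R (rightAct R c b) (rightAct R (leftAct R b c) a) = a * b * c := by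
    rw [mul_assoc, compat, ← mul_assoc, compat, mul_assoc, compat, mul_assoc]
  rw [← hR, h1, h3] at hL
  exact Prod.ext h1 (Prod.ext (mul_left_cancel (mul_right_cancel hL)) h3)

theorem IsBraidedMonoid.eq_mul_right [Monoid M] {R R' : M × M → M × M}
    (hR : IsBraidedMonoid M R) (hR' : IsBraidedMonoid M R') {a u v : M}
    (h : R (a, u) = R' (a, u)) (h' : R (rightAct R u a, v) = R' (rightAct R u a, v)) :
    R (a, u * v) = R' (a, u * v) := by
  have h1 : leftAct R a u = leftAct R' a u := congrArg Prod.fst h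
  have h2 : rightAct R u a = rightAct R' u a := congrArg Prod.snd h
  have h3 : leftAct R (rightAct R u a) v = leftAct R' (rightAct R u a) v := congrArg Prod.fst h'
  have h4 : rightAct R v (rightAct R u a) = rightAct R' v (rightAct R u a) :=
    congrArg Prod.snd h'
  refine Prod.ext ?_ ?_
  · change leftAct R a (u * v) = leftAct R' a (u * v)
    rw [hR.left_mul, hR'.left_mul, h1, h3, h2]
  · change rightAct R (u * v) a = rightAct R' (u * v) a
    rw [hR.right_mul, hR'.right_mul, h4, h2]

theorem IsBraidedMonoid.eq_mul_left [Monoid M] {R R' : M × M → M × M}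
    (hR : IsBraidedMonoid M R) (hR' : IsBraidedMonoid M R') {a b u : M}
    (h : R (b, u) = R' (b, u)) (h' : R (a, leftAct R b u) = R' (a, leftAct R b u)) :
    R (a * b, u) = R' (a * b, u) := by
  have h1 : leftAct R b u = leftAct R' b u := congrArg Prod.fst h
  have h2 : rightAct R u b = rightAct R' u b := congrArg Prod.snd h
  have h3 : leftAct R a (leftAct R b u) = leftAct R' a (leftAct R b u) := congrArg Prod.fst h'
  have h4 : rightAct R (leftAct R b u) a = rightAct R' (leftAct R b u) a := congrArg Prod.snd h'
  refine Prod.ext ?_ ?_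
  · change leftAct R (a * b) u = leftAct R' (a * b) u
    rw [hR.mul_left, hR'.mul_left, h3, h1]
  · change rightAct R u (a * b) = rightAct R' u (a * b)
    rw [hR.mul_right, hR'.mul_right, h4, h2, h1]

theorem IsBraidedMonoid.leftAct_injective [Group M] {R : M × M → M × M}
    (hR : IsBraidedMonoid M R) (a : M) : Function.Injective (leftAct R a) := by
  refine Function.LeftInverse.injective (g := leftAct R a⁻¹) fun u => ?_
  rw [← hR.mul_left, inv_mul_cancel, hR.one_left]

theorem IsBraidedMonoid.rightAct_rightAct_inv [Group M] {R : M × M → M × M}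
    (hR : IsBraidedMonoid M R) (u a : M) : rightAct R u (rightAct R u⁻¹ a) = a := by
  rw [← hR.right_mul, inv_mul_cancel, hR.right_one]

theorem IsBraidedMonoid.rightAct_inv_rightAct [Group M] {R : M × M → M × M}
    (hR : IsBraidedMonoid M R) (u a : M) : rightAct R u⁻¹ (rightAct R u a) = a := by
  rw [← hR.right_mul, mul_inv_cancel, hR.right_one]

variable {X : Type*} {r : X × X → X × X}

/-- The right action of `S` carries generators to generators, so the values at `(x, u)` are forced
by induction on `u`, and then all values by induction on the first entry. -/
theorem isBraidedExtension_mon_unique {R R' : Mon r × Mon r → Mon r × Mon r}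
    (hR : IsBraidedExtension r (monOf r) R) (hR' : IsBraidedExtension r (monOf r) R') :
    R = R' := by
  obtain ⟨hR, he⟩ := hR
  obtain ⟨hR', he'⟩ := hR'
  have gen : ∀ (u : Mon r) (x : X), R (monOf r x, u) = R' (monOf r x, u) ∧
      ∃ y, rightAct R u (monOf r x) = monOf r y := by
    intro u
    induction u using mon_induction with
    | one =>
      exact fun x => ⟨Prod.ext ((hR.left_one _).trans (hR'.left_one _).symm)
        ((hR.right_one _).trans (hR'.right_one _).symm), x, hR.right_one _⟩
    | mul u y ih =>
      intro x
      obtain ⟨h, z, hz⟩ := ih x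
      refine ⟨hR.eq_mul_right hR' h ?_, rightAct r y z, ?_⟩
      · rw [hz, he, he']
      · rw [hR.right_mul, hz]
        exact congrArg Prod.snd (he z y)
  refine funext ?_
  rintro ⟨a, u⟩
  induction a using mon_induction generalizing u with
  | one =>
    exact Prod.ext ((hR.one_left _).trans (hR'.one_left _).symm)
      ((hR.one_right _).trans (hR'.one_right _).symm)
  | mul a x ih => exact hR.eq_mul_left hR' (gen u x).1 (ih _)

/-- Forced by letting `z` act on `y y⁻¹ = 1`. As `𝓡_y` is surjective, every generator has the form
`zʸ`. -/
theorem IsBraidedExtension.apply_inv {R : Grp r × Grp r → Grp r × Grp r}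
    (hR : IsBraidedExtension r (grpOf r) R) (z y : X) :
    R (grpOf r (rightAct r y z), (grpOf r y)⁻¹) =
      ((grpOf r (leftAct r z y))⁻¹, grpOf r z) := by
  obtain ⟨hR, he⟩ := hR
  have h1 : leftAct R (grpOf r z) (grpOf r y) = grpOf r (leftAct r z y) :=
    congrArg Prod.fst (he z y)
  have h2 : rightAct R (grpOf r y) (grpOf r z) = grpOf r (rightAct r y z) :=
    congrArg Prod.snd (he z y)
  refine Prod.ext ?_ ?_
  · change leftAct R _ _ = _
    rw [eq_inv_iff_mul_eq_one, mul_eq_one_iff_eq_inv', ← h1, ← h2,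
      eq_inv_iff_mul_eq_one, ← hR.left_mul, mul_inv_cancel, hR.left_one]
  · change rightAct R _ _ = _
    rw [← h2, hR.rightAct_inv_rightAct]

theorem isBraidedExtension_grp_unique (hn : IsNonDegenerate r)
    {R R' : Grp r × Grp r → Grp r × Grp r}
    (hR : IsBraidedExtension r (grpOf r) R) (hR' : IsBraidedExtension r (grpOf r) R') :
    R = R' := by
  have hinv := hR.apply_inv
  have hinv' := hR'.apply_inv
  obtain ⟨hR, he⟩ := hR
  obtain ⟨hR', he'⟩ := hR'
  have gen : ∀ (u : Grp r) (x : X), R (grpOf r x, u) = R' (grpOf r x, u) ∧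
      ∃ y, rightAct R u (grpOf r x) = grpOf r y := by
    intro u
    induction u using grp_induction with
    | one =>
      exact fun x => ⟨Prod.ext ((hR.left_one _).trans (hR'.left_one _).symm)
        ((hR.right_one _).trans (hR'.right_one _).symm), x, hR.right_one _⟩
    | mul u y ih =>
      intro x
      obtain ⟨h, z, hz⟩ := ih x
      refine ⟨hR.eq_mul_right hR' h ?_, rightAct r y z, ?_⟩
      · rw [hz, he, he']
      · rw [hR.right_mul, hz]
        exact congrArg Prod.snd (he z y)
    | mul_inv u y ih =>
      intro x
      obtain ⟨h, z, hz⟩ := ih x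
      obtain ⟨z, rfl⟩ := (hn y).2.2 z
      refine ⟨hR.eq_mul_right hR' h ?_, z, ?_⟩
      · rw [hz, hinv, hinv']
      · rw [hR.right_mul, hz]
        exact congrArg Prod.snd (hinv z y)
  -- The left action of `x⁻¹` inverts that of `x`; the right component is then fixed by `compat`.
  have gen_inv : ∀ (u : Grp r) (x : X), R ((grpOf r x)⁻¹, u) = R' ((grpOf r x)⁻¹, u) := by
    intro u x
    have h1 : leftAct R (grpOf r x)⁻¹ u = leftAct R' (grpOf r x)⁻¹ u := by
      apply hR.leftAct_injective (grpOf r x)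
      have : leftAct R (grpOf r x) (leftAct R' (grpOf r x)⁻¹ u) =
          leftAct R' (grpOf r x) (leftAct R' (grpOf r x)⁻¹ u) := congrArg Prod.fst (gen _ x).1
      rw [this, ← hR.mul_left, ← hR'.mul_left, mul_inv_cancel, hR.one_left, hR'.one_left]
    refine Prod.ext h1 ?_
    have h2 := (hR.compat (grpOf r x)⁻¹ u).trans (hR'.compat (grpOf r x)⁻¹ u).symm
    rw [h1] at h2
    exact mul_left_cancel h2
  refine funext ?_
  rintro ⟨a, u⟩
  induction a using grp_induction generalizing u with
  | one =>
    exact Prod.ext ((hR.one_left _).trans (hR'.one_left _).symm)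
      ((hR.one_right _).trans (hR'.one_right _).symm)
  | mul a x ih => exact hR.eq_mul_left hR' (gen u x).1 (ih _)
  | mul_inv a x ih => exact hR.eq_mul_left hR' (gen_inv u x) (ih _)

end BraidedMonoids

/-! ### Braidings from injective cocycles with values in an abelian group. -/

section Cocycle

variable {M N H : Type*} [Monoid M] [CommGroup N] [Group H] {φ : H →* MulAut N}

/-- The first component of `Ψ : M →* N ⋊[φ] H` is injective with range stable under `H`. -/
structure IsCocycle (Ψ : M →* N ⋊[φ] H) : Prop where
  inj : ∀ a b, (Ψ a).left = (Ψ b).left → a = b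
  stable : ∀ h a, ∃ b, (Ψ b).left = φ h (Ψ a).left

variable {Ψ : M →* N ⋊[φ] H}

/-- The action of `H` on `M` transported along the first component of `Ψ`. -/
noncomputable def IsCocycle.act (hΨ : IsCocycle Ψ) (h : H) (a : M) : M :=
  (hΨ.stable h a).choose

/-- The braiding of `M` defined by the cocycle `Ψ`. -/
noncomputable def IsCocycle.braiding (hΨ : IsCocycle Ψ) (p : M × M) : M × M :=
  (hΨ.act (Ψ p.1).right p.2, hΨ.act (Ψ (hΨ.act (Ψ p.1).right p.2)).right⁻¹ p.1)

namespace IsCocycle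

theorem left_act (hΨ : IsCocycle Ψ) (h : H) (a : M) : (Ψ (hΨ.act h a)).left = φ h (Ψ a).left :=
  (hΨ.stable h a).choose_spec

theorem act_mul (hΨ : IsCocycle Ψ) (h k : H) (a : M) :
    hΨ.act (h * k) a = hΨ.act h (hΨ.act k a) :=
  hΨ.inj _ _ (by simp [left_act])

@[simp] theorem act_one (hΨ : IsCocycle Ψ) (a : M) : hΨ.act 1 a = a :=
  hΨ.inj _ _ (by simp [left_act])

@[simp] theorem act_inv_act (hΨ : IsCocycle Ψ) (h : H) (a : M) :
    hΨ.act h⁻¹ (hΨ.act h a) = a := by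
  rw [← act_mul, inv_mul_cancel, act_one]

@[simp] theorem act_act_inv (hΨ : IsCocycle Ψ) (h : H) (a : M) :
    hΨ.act h (hΨ.act h⁻¹ a) = a := by
  rw [← act_mul, mul_inv_cancel, act_one]

theorem leftAct_braiding (hΨ : IsCocycle Ψ) (a u : M) :
    leftAct hΨ.braiding a u = hΨ.act (Ψ a).right u := rfl

theorem rightAct_braiding (hΨ : IsCocycle Ψ) (a u : M) :
    rightAct hΨ.braiding u a = hΨ.act (Ψ (leftAct hΨ.braiding a u)).right⁻¹ a := rfl

theorem isCancelMul (hΨ : IsCocycle Ψ) : IsCancelMul M := by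
  have hinj : Function.Injective Ψ := fun a b h => hΨ.inj a b (by rw [h])
  exact { mul_left_cancel := fun a b c h => hinj (mul_left_cancel (a := Ψ a) (by
            rw [← map_mul, ← map_mul]; exact congrArg Ψ h))
          mul_right_cancel := fun a b c h => hinj (mul_right_cancel (b := Ψ a) (by
            rw [← map_mul, ← map_mul]; exact congrArg Ψ h)) }

/-- Commutativity of `N` enters here: the two products have the first components of `u` and of `ᵘv`
as factors, in opposite orders. -/
theorem compat (hΨ : IsCocycle Ψ) (u v : M) :
    leftAct hΨ.braiding u v * rightAct hΨ.braiding v u = u * v := by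
  refine hΨ.inj _ _ ?_
  rw [map_mul, map_mul, SemidirectProduct.mul_left, SemidirectProduct.mul_left,
    rightAct_braiding, left_act, ← MulAut.mul_apply, ← map_mul, mul_inv_cancel, map_one,
    MulAut.one_apply, leftAct_braiding, left_act, mul_comm]

theorem mul_left (hΨ : IsCocycle Ψ) (a b u : M) :
    leftAct hΨ.braiding (a * b) u = leftAct hΨ.braiding a (leftAct hΨ.braiding b u) := by
  rw [leftAct_braiding, map_mul, SemidirectProduct.mul_right, act_mul]; rfl

theorem left_mul (hΨ : IsCocycle Ψ) (a u v : M) :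
    leftAct hΨ.braiding a (u * v) =
      leftAct hΨ.braiding a u * leftAct hΨ.braiding (rightAct hΨ.braiding u a) v := by
  refine hΨ.inj _ _ ?_
  rw [map_mul, SemidirectProduct.mul_left]
  have h : φ (Ψ (leftAct hΨ.braiding a u)).right
      (Ψ (leftAct hΨ.braiding (rightAct hΨ.braiding u a) v)).left =
      (Ψ (leftAct hΨ.braiding (a * u) v)).left := by
    rw [← hΨ.compat a u, hΨ.mul_left, hΨ.leftAct_braiding (leftAct hΨ.braiding a u), left_act]
  rw [h]
  simp only [leftAct_braiding, left_act, map_mul, SemidirectProduct.mul_left,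
    SemidirectProduct.mul_right, MulAut.mul_apply]

theorem involutive (hΨ : IsCocycle Ψ) : Function.Involutive hΨ.braiding := by
  have := hΨ.isCancelMul
  rintro ⟨a, b⟩
  have h1 : leftAct hΨ.braiding (leftAct hΨ.braiding a b) (rightAct hΨ.braiding b a) = a := by
    rw [leftAct_braiding _ (leftAct _ _ _), rightAct_braiding, act_act_inv]
  have h2 := hΨ.compat (leftAct hΨ.braiding a b) (rightAct hΨ.braiding b a)
  rw [h1, hΨ.compat] at h2
  exact Prod.ext h1 (mul_left_cancel h2)

theorem isBraidedMonoid (hΨ : IsCocycle Ψ) : IsBraidedMonoid M hΨ.braiding := by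
  have := hΨ.isCancelMul
  have left_one : ∀ a, leftAct hΨ.braiding a 1 = 1 := fun a =>
    hΨ.inj _ _ (by rw [leftAct_braiding, left_act, map_one, SemidirectProduct.one_left, map_one])
  have one_left : ∀ u, leftAct hΨ.braiding 1 u = u := fun u => by
    rw [leftAct_braiding, map_one, SemidirectProduct.one_right, act_one]
  have right_mul : ∀ a u v, rightAct hΨ.braiding (u * v) a =
      rightAct hΨ.braiding v (rightAct hΨ.braiding u a) := by
    intro a u v
    apply mul_left_cancel (a := leftAct hΨ.braiding a (u * v))
    rw [hΨ.compat, hΨ.left_mul, mul_assoc, hΨ.compat, ← mul_assoc, ← mul_assoc, hΨ.compat]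
  exact
    { left_one := left_one
      one_left := one_left
      one_right := fun u => mul_left_cancel (a := leftAct hΨ.braiding 1 u) (by
        rw [hΨ.compat, one_left, one_mul, mul_one])
      right_one := fun a => mul_left_cancel (a := leftAct hΨ.braiding a 1) (by
        rw [hΨ.compat, left_one, one_mul, mul_one])
      mul_left := hΨ.mul_left
      right_mul := right_mul
      left_mul := hΨ.left_mul
      mul_right := fun a b u => mul_left_cancel (a := leftAct hΨ.braiding (a * b) u) (by
        rw [hΨ.compat, hΨ.mul_left, ← mul_assoc, hΨ.compat, mul_assoc, mul_assoc, hΨ.compat])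
      compat := hΨ.compat
      braided := isBraidedSet_of_axioms hΨ.involutive.bijective hΨ.mul_left right_mul hΨ.compat }

theorem leftAct_bijective (hΨ : IsCocycle Ψ) (a : M) :
    Function.Bijective (leftAct hΨ.braiding a) :=
  Function.bijective_iff_has_inverse.2
    ⟨hΨ.act (Ψ a).right⁻¹, fun u => hΨ.act_inv_act _ u, fun u => hΨ.act_act_inv _ u⟩

variable {M' : Type*} [Monoid M'] {Ψ' : M' →* N ⋊[φ] H} {i : M →* M'}

theorem map_act (hΨ : IsCocycle Ψ) (hΨ' : IsCocycle Ψ') (hi : ∀ a, Ψ' (i a) = Ψ a)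
    (h : H) (a : M) : i (hΨ.act h a) = hΨ'.act h (i a) :=
  hΨ'.inj _ _ (by rw [hi, left_act, left_act, hi])

theorem map_braiding (hΨ : IsCocycle Ψ) (hΨ' : IsCocycle Ψ') (hi : ∀ a, Ψ' (i a) = Ψ a)
    (u v : M) : hΨ'.braiding (i u, i v) = (i (hΨ.braiding (u, v)).1, i (hΨ.braiding (u, v)).2) := by
  simp only [braiding, hΨ.map_act hΨ' hi, hi]
  rw [← hΨ.map_act hΨ' hi, hi]

end IsCocycle

theorem IsCocycle.isNonDegenerate_of_group {G : Type*} [Group G] {Ψ : G →* N ⋊[φ] H}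
    (hΨ : IsCocycle Ψ) : IsNonDegenerate hΨ.braiding := fun u =>
  ⟨hΨ.leftAct_bijective u, Function.bijective_iff_has_inverse.2
    ⟨rightAct hΨ.braiding u⁻¹, hΨ.isBraidedMonoid.rightAct_inv_rightAct u,
      hΨ.isBraidedMonoid.rightAct_rightAct_inv u⟩⟩

/-- A submonoid of a group whose cocycle restricts to it is non-degenerate. -/
theorem IsCocycle.isNonDegenerate_of_hom {G : Type*} [Group G] {Ψ' : G →* N ⋊[φ] H}
    (hΨ : IsCocycle Ψ) (hΨ' : IsCocycle Ψ') {i : M →* G} (hi : ∀ a, Ψ' (i a) = Ψ a) :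
    IsNonDegenerate hΨ.braiding := by
  have hinj : Function.Injective i := fun a b h => hΨ.inj a b (by rw [← hi, h, hi])
  have hmap : ∀ u a, i (rightAct hΨ.braiding u a) = rightAct hΨ'.braiding (i u) (i a) :=
    fun u a => (congrArg Prod.snd (hΨ.map_braiding hΨ' hi a u)).symm
  refine fun u => ⟨hΨ.leftAct_bijective u, fun a b h => hinj ?_, fun b => ?_⟩
  · exact (hΨ'.isNonDegenerate_of_group (i u)).2.1 (by rw [← hmap, ← hmap, h])
  -- The preimage in the group is the result of letting `(i u)⁻¹` act on `i b` from the right. That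
  -- action is given by an element of `H`, and `H` preserves the image of `M`.
  · refine ⟨hΨ.act (Ψ' (leftAct hΨ'.braiding (i b) (i u)⁻¹)).right⁻¹ b, hinj ?_⟩
    rw [hmap, hΨ.map_act hΨ' hi, ← IsCocycle.rightAct_braiding,
      hΨ'.isBraidedMonoid.rightAct_rightAct_inv]

end Cocycle

/-! ### The cocycles of `S` and `G` in `ℤ^X ⋊ Sym X`. -/

section Wreath

variable {X : Type*} {r : X × X → X × X}

theorem mon_exists_list (s : Mon r) : ∃ w : List X, (w.map (monOf r)).prod = s := by
  induction s using mon_induction with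
  | one => exact ⟨[], rfl⟩
  | mul s x ih =>
    obtain ⟨w, rfl⟩ := ih
    exact ⟨w ++ [x], by simp⟩

open Classical in
/-- The generator of `ℤ^X` at `x`, written multiplicatively. -/
noncomputable def basisElt (x : X) : X → Multiplicative ℤ :=
  Pi.mulSingle x (Multiplicative.ofAdd 1)

@[simp] theorem mulAutArrow_basisElt (σ : Equiv.Perm X) (x : X) :
    mulAutArrow σ (basisElt x) = basisElt (σ x) := by
  funext y
  change basisElt x (σ⁻¹ y) = basisElt (σ x) y
  simp only [basisElt, Pi.mulSingle_apply]
  by_cases h : y = σ x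
  · rw [h, if_pos rfl, if_pos (perm_inv_apply_self σ x)]
  · rw [if_neg h, if_neg fun e : σ⁻¹ y = x => h (σ.symm_apply_eq.1 e)]

theorem perm_of_prod_basisElt_eq {l l' : List X}
    (h : (l.map basisElt).prod = (l'.map basisElt).prod) : l.Perm l' := by
  classical
  have key : ∀ (l : List X) (y : X),
      (l.map basisElt).prod y = Multiplicative.ofAdd (l.count y : ℤ) := by
    intro l y
    induction l with
    | nil => rfl
    | cons x l ih =>
      rw [List.map_cons, List.prod_cons, Pi.mul_apply, ih, List.count_cons, basisElt,
        Pi.mulSingle_apply]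
      by_cases hxy : y = x
      · simp [hxy, ← ofAdd_add, add_comm]
      · simp [hxy, Ne.symm hxy]
  rw [List.perm_iff_count]
  intro y
  have := congrFun h y
  rw [key, key] at this
  exact_mod_cast Multiplicative.ofAdd.injective this

/-- The homomorphism `G(X, r) → ℤ^X ⋊ Sym X` of an involutive solution. -/
noncomputable def grpToWreath (hb : IsBraidedSet r) (hn : IsNonDegenerate r)
    (hs : IsSquareFree r) (hr : Function.Involutive r) :
    Grp r →* (X → Multiplicative ℤ) ⋊[mulAutArrow] Equiv.Perm X :=
  grpLift (fun x => ⟨basisElt x, leftPerm hn x⟩) fun x y => by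
    -- The first components are `e_x` and `e_{ˣy}` in either order, because the generator `ˣy`
    -- carries `xʸ` back to `x`.
    have h := (involutive_iff_derived hb hn hs).1 hr (leftAct r x y) x
    rw [derived, rightAct_leftAct_self hb hn hs] at h
    refine SemidirectProduct.ext ?_ (leftPerm_mul hb hn x y)
    simp [h, mul_comm]

@[simp] theorem grpToWreath_grpOf (hb : IsBraidedSet r) (hn : IsNonDegenerate r)
    (hs : IsSquareFree r) (hr : Function.Involutive r) (x : X) :
    grpToWreath hb hn hs hr (grpOf r x) = ⟨basisElt x, leftPerm hn x⟩ :=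
  grpLift_grpOf _ _ _

/-- The homomorphism `S(X, r) → ℤ^X ⋊ Sym X` of an involutive solution. -/
noncomputable def monToWreath (hb : IsBraidedSet r) (hn : IsNonDegenerate r)
    (hs : IsSquareFree r) (hr : Function.Involutive r) :
    Mon r →* (X → Multiplicative ℤ) ⋊[mulAutArrow] Equiv.Perm X :=
  (grpToWreath hb hn hs hr).comp (monToGrp r)

theorem monToWreath_monOf (hb : IsBraidedSet r) (hn : IsNonDegenerate r)
    (hs : IsSquareFree r) (hr : Function.Involutive r) (x : X) :
    monToWreath hb hn hs hr (monOf r x) = ⟨basisElt x, leftPerm hn x⟩ := by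
  rw [monToWreath, MonoidHom.comp_apply, monToGrp_of, grpToWreath_grpOf]

theorem monToWreath_right (hb : IsBraidedSet r) (hn : IsNonDegenerate r)
    (hs : IsSquareFree r) (hr : Function.Involutive r) (s : Mon r) :
    (monToWreath hb hn hs hr s).right = monPerm hb hn s := by
  induction s using mon_induction with
  | one => simp
  | mul s x ih => simp [ih, monToWreath_monOf]

/-- A sweep appends `s⁻¹ x`, whose basis vector is twisted by `s` into exactly `e_x`. -/
theorem monToWreath_sweep_left (hb : IsBraidedSet r) (hn : IsNonDegenerate r)
    (hs : IsSquareFree r) (hr : Function.Involutive r) (l : List X) :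
    (monToWreath hb hn hs hr
      (((l.map (sweep hb hn)).prod.unop : Mon r → Mon r) 1)).left = (l.map basisElt).prod := by
  induction l using List.reverseRecOn with
  | nil => exact congrArg SemidirectProduct.left (map_one (monToWreath hb hn hs hr))
  | append_singleton l x ih =>
    rw [sweep_append_apply, map_mul, SemidirectProduct.mul_left, ih, monToWreath_right,
      monToWreath_monOf, mulAutArrow_basisElt, List.map_append, List.prod_append]
    simp

theorem exists_sweep_apply_one_eq (hb : IsBraidedSet r) (hn : IsNonDegenerate r) (s : Mon r) :
    ∃ l : List X, ((l.map (sweep hb hn)).prod.unop : Mon r → Mon r) 1 = s := by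
  obtain ⟨w, rfl⟩ := mon_exists_list s
  obtain ⟨l, -, h⟩ := exists_sweep_eq hb hn w
  exact ⟨l, h⟩

theorem isCocycle_monToWreath (hb : IsBraidedSet r) (hn : IsNonDegenerate r)
    (hs : IsSquareFree r) (hr : Function.Involutive r) :
    IsCocycle (monToWreath hb hn hs hr) where
  inj s t h := by
    obtain ⟨l, rfl⟩ := exists_sweep_apply_one_eq hb hn s
    obtain ⟨l', rfl⟩ := exists_sweep_apply_one_eq hb hn t
    rw [monToWreath_sweep_left, monToWreath_sweep_left] at h
    -- With trivial derived operation the sweeps commute, so the multiset of labels, read off from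
    -- the cocycle, determines the element.
    have hc : ∀ u v, Commute (sweep hb hn u) (sweep hb hn v) := fun u v => by
      rw [commute_iff_eq, sweep_mul_sweep hb hn hs, (involutive_iff_derived hb hn hs).1 hr]
    rw [((perm_of_prod_basisElt_eq h).map (sweep hb hn)).prod_eq'
      (List.pairwise_map.2 (List.pairwise_of_forall hc))]
  stable σ s := by
    obtain ⟨l, rfl⟩ := exists_sweep_apply_one_eq hb hn s
    refine ⟨(((l.map σ).map (sweep hb hn)).prod.unop : Mon r → Mon r) 1, ?_⟩
    rw [monToWreath_sweep_left, monToWreath_sweep_left, map_list_prod, List.map_map, List.map_map]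
    congr 2
    funext x
    simp

theorem monToGrp_injective (hb : IsBraidedSet r) (hn : IsNonDegenerate r)
    (hs : IsSquareFree r) (hr : Function.Involutive r) : Function.Injective (monToGrp r) :=
  fun s t h => (isCocycle_monToWreath hb hn hs hr).inj s t (by
    rw [monToWreath, MonoidHom.comp_apply, h, MonoidHom.comp_apply])

theorem exists_mul_pow_actionLcm [Fintype X] (hb : IsBraidedSet r) (hn : IsNonDegenerate r)
    (hs : IsSquareFree r) (t : Mon r) (x : X) :
    ∃ y, t * monOf r x ^ actionLcm r = monOf r y ^ actionLcm r * t := by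
  induction t using mon_induction generalizing x with
  | one => exact ⟨x, by simp⟩
  | mul t a ih =>
    obtain ⟨y, hy⟩ := ih (leftAct r a x)
    exact ⟨y, by rw [mul_assoc, monOf_mul_pow_actionLcm hb hn hs, ← mul_assoc, hy, mul_assoc]⟩

/-- `G(X, r)` is the group of left fractions of `S(X, r)`. -/
theorem grp_exists_fraction [Fintype X] (hb : IsBraidedSet r) (hn : IsNonDegenerate r)
    (hs : IsSquareFree r) (g : Grp r) :
    ∃ s t : Mon r, g = (monToGrp r s)⁻¹ * monToGrp r t := by
  induction g using grp_induction with
  | one => exact ⟨1, 1, by simp⟩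
  | mul g x ih =>
    obtain ⟨s, t, rfl⟩ := ih
    exact ⟨s, t * monOf r x, by rw [map_mul, monToGrp_of, mul_assoc]⟩
  | mul_inv g x ih =>
    obtain ⟨s, t, rfl⟩ := ih
    obtain ⟨y, hy⟩ := exists_mul_pow_actionLcm hb hn hs t x
    refine ⟨monOf r y ^ actionLcm r * s, t * monOf r x ^ (actionLcm r - 1), ?_⟩
    have h : monToGrp r t * grpOf r x ^ actionLcm r =
        grpOf r y ^ actionLcm r * monToGrp r t := by
      simpa [monToGrp_of] using congrArg (monToGrp r) hy
    obtain ⟨k, hk⟩ := Nat.exists_eq_succ_of_ne_zero (actionLcm_pos hn).ne'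
    -- Write `x⁻¹ = x⁻ᵖ xᵖ⁻¹` and carry `x⁻ᵖ` to the left of `t`, where it becomes `y⁻ᵖ`.
    have h2 : monToGrp r t * (grpOf r x)⁻¹ =
        (grpOf r y ^ actionLcm r)⁻¹ * (monToGrp r t * grpOf r x ^ (actionLcm r - 1)) := by
      rw [eq_inv_mul_iff_mul_eq, ← mul_assoc, ← h, hk, Nat.succ_eq_add_one, Nat.add_sub_cancel,
        pow_succ]
      group
    rw [mul_assoc, h2, map_mul, map_mul, map_pow, map_pow, monToGrp_of, monToGrp_of]
    group

theorem isCocycle_grpToWreath [Fintype X] (hb : IsBraidedSet r) (hn : IsNonDegenerate r)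
    (hs : IsSquareFree r) (hr : Function.Involutive r) :
    IsCocycle (grpToWreath hb hn hs hr) where
  inj g h e := by
    -- A fraction `s⁻¹ t` with trivial first component has `s` and `t` of equal first component, so
    -- injectivity on `S` applies.
    obtain ⟨s, t, hst⟩ := grp_exists_fraction hb hn hs (g⁻¹ * h)
    have h1 : (grpToWreath hb hn hs hr (g⁻¹ * h)).left = 1 := by
      rw [map_mul, map_inv, SemidirectProduct.mul_left, SemidirectProduct.inv_left,
        SemidirectProduct.inv_right, ← e, ← map_mul, inv_mul_cancel, map_one]
    rw [hst, map_mul, map_inv, SemidirectProduct.mul_left, SemidirectProduct.inv_left,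
      SemidirectProduct.inv_right, ← map_mul, EmbeddingLike.map_eq_one_iff] at h1
    have h2 : (monToWreath hb hn hs hr s).left = (monToWreath hb hn hs hr t).left :=
      inv_mul_eq_one.1 h1
    rw [(isCocycle_monToWreath hb hn hs hr).inj s t h2, inv_mul_cancel] at hst
    exact (inv_mul_eq_one.1 hst)
  stable σ g := by
    induction g using grp_induction with
    | one => exact ⟨1, by simp⟩
    | mul g x ih =>
      obtain ⟨g', hg'⟩ := ih
      refine ⟨g' * grpOf r ((grpToWreath hb hn hs hr g').right⁻¹
        (σ ((grpToWreath hb hn hs hr g).right x))), ?_⟩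
      simp [hg']
    | mul_inv g x ih =>
      obtain ⟨g', hg'⟩ := ih
      have key : ∀ (g : Grp r) (x : X), (grpToWreath hb hn hs hr (g * (grpOf r x)⁻¹)).left =
          (grpToWreath hb hn hs hr g).left *
            (basisElt ((grpToWreath hb hn hs hr g).right x))⁻¹ := by
        intro g x
        -- Square-freeness removes the twist in the first component of `x⁻¹`, which is thus the
        -- inverse of `e_x`.
        have : (leftPerm hn x)⁻¹ x = x := by
          rw [Equiv.Perm.inv_eq_iff_eq, leftPerm_apply, leftAct_self hs]
        rw [map_mul, map_inv, grpToWreath_grpOf, SemidirectProduct.mul_left,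
          SemidirectProduct.inv_left, map_inv (mulAutArrow (leftPerm hn x)⁻¹),
          mulAutArrow_basisElt, this, map_inv, mulAutArrow_basisElt]
      refine ⟨g' * (grpOf r ((grpToWreath hb hn hs hr g').right⁻¹
        (σ ((grpToWreath hb hn hs hr g).right x))))⁻¹, ?_⟩
      rw [key, key, map_mul, hg', map_inv, mulAutArrow_basisElt]
      simp

theorem isBraidedExtension_of_isCocycle (hn : IsNonDegenerate r) {M : Type*} [Monoid M]
    {Ψ : M →* (X → Multiplicative ℤ) ⋊[mulAutArrow] Equiv.Perm X} (hΨ : IsCocycle Ψ) {ι : X → M}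
    (hι : ∀ x, Ψ (ι x) = ⟨basisElt x, leftPerm hn x⟩)
    (hmul : ∀ x y, ι x * ι y = ι (leftAct r x y) * ι (rightAct r y x)) :
    IsBraidedExtension r ι hΨ.braiding := by
  have := hΨ.isCancelMul
  refine ⟨hΨ.isBraidedMonoid, fun x y => ?_⟩
  have h : leftAct hΨ.braiding (ι x) (ι y) = ι (leftAct r x y) :=
    hΨ.inj _ _ (by rw [hΨ.leftAct_braiding, hΨ.left_act, hι, hι, hι, mulAutArrow_basisElt]; rfl)
  refine Prod.ext h (mul_left_cancel (a := ι (leftAct r x y)) ?_)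
  rw [← h]
  exact (hΨ.compat _ _).trans ((hmul x y).trans (by rw [h]; rfl))

end Wreath

/-! ### Growth of the algebra and its Gelfand–Kirillov dimension. -/

section Algebra

open Filter Topology

variable {X : Type*} {r : X × X → X × X} {k : Type*} [Field k]

/-- The multiplicative map `S(X, r) → A(k, X, r)`. -/
noncomputable def monToAlg (k : Type*) [Field k] (r : X × X → X × X) : Mon r →* Alg k r :=
  monLift (fun x => RingQuot.mkAlgHom k (AlgRel k r) (FreeAlgebra.ι k x)) fun x y => by
    rw [← map_mul, ← map_mul]
    by_cases h : r (x, y) = (x, y)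
    · simp [leftAct, rightAct, h]
    · exact RingQuot.mkAlgHom_rel k (AlgRel.mk x y h)

theorem monToAlg_monOf (x : X) :
    monToAlg k r (monOf r x) = RingQuot.mkAlgHom k (AlgRel k r) (FreeAlgebra.ι k x) :=
  monLift_monOf _ _ _

/-- The relations of `A` hold in the monoid algebra of `S`, and the induced map sends these elements
to its basis. -/
theorem linearIndependent_monToAlg : LinearIndependent k (monToAlg k r) := by
  let f : Alg k r →ₐ[k] MonoidAlgebra k (Mon r) :=
    RingQuot.liftAlgHom k ⟨FreeAlgebra.lift k fun x => MonoidAlgebra.of k (Mon r) (monOf r x), by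
      rintro _ _ ⟨x, y, h⟩
      simp only [map_mul, FreeAlgebra.lift_ι_apply]
      rw [← map_mul, ← map_mul, monOf_mul_monOf]
      rfl⟩
  have hf : ∀ s, f (monToAlg k r s) = MonoidAlgebra.of k (Mon r) s := by
    intro s
    induction s using mon_induction with
    | one => simp only [map_one]
    | mul s x ih =>
      rw [map_mul, map_mul, map_mul, ih, monToAlg_monOf, RingQuot.liftAlgHom_mkAlgHom_apply,
        FreeAlgebra.lift_ι_apply]
  refine LinearIndependent.of_comp
    ((MonoidAlgebra.coeffLinearEquiv k).toLinearMap ∘ₗ f.toLinearMap) ?_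
  convert Finsupp.linearIndependent_single_one k (Mon r) using 1
  funext s
  change MonoidAlgebra.coeff (f (monToAlg k r s)) = _
  rw [hf]
  rfl

/-- The span in `A(k, X, r)` of the words of length at most `m`. -/
noncomputable def wordSpan (k : Type*) [Field k] (r : X × X → X × X) (m : ℕ) :
    Submodule k (Alg k r) :=
  Submodule.span k {a | ∃ w : List X, w.length ≤ m ∧ monToAlg k r (w.map (monOf r)).prod = a}

theorem monToAlg_mem_wordSpan {m : ℕ} {w : List X} (h : w.length ≤ m) :
    monToAlg k r (w.map (monOf r)).prod ∈ wordSpan k r m :=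
  Submodule.subset_span ⟨w, h, rfl⟩

theorem wordSpan_mono {m m' : ℕ} (h : m ≤ m') : wordSpan k r m ≤ wordSpan k r m' :=
  Submodule.span_mono fun _ ⟨w, hw, e⟩ => ⟨w, hw.trans h, e⟩

theorem wordSpan_mul_le (m m' : ℕ) :
    wordSpan k r m * wordSpan k r m' ≤ wordSpan k r (m + m') := by
  rw [wordSpan, wordSpan, Submodule.span_mul_span]
  refine Submodule.span_le.2 ?_
  rintro _ ⟨_, ⟨w, hw, rfl⟩, _, ⟨w', hw', rfl⟩, rfl⟩
  have : monToAlg k r (w.map (monOf r)).prod * monToAlg k r (w'.map (monOf r)).prod =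
      monToAlg k r ((w ++ w').map (monOf r)).prod := by simp
  change monToAlg k r (w.map (monOf r)).prod * monToAlg k r (w'.map (monOf r)).prod ∈ _
  rw [this]
  exact monToAlg_mem_wordSpan (by simp only [List.length_append]; omega)

theorem one_mem_wordSpan (m : ℕ) : (1 : Alg k r) ∈ wordSpan k r m := by
  simpa using monToAlg_mem_wordSpan (k := k) (r := r) (w := []) (Nat.zero_le m)

theorem wordSpan_pow_le (d i : ℕ) : wordSpan k r d ^ i ≤ wordSpan k r (d * i) := by
  induction i with
  | zero => simpa using one_mem_wordSpan _
  | succ i ih =>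
    rw [pow_succ, Nat.mul_succ]
    exact (mul_le_mul_left ih _).trans (wordSpan_mul_le _ _)

theorem exists_mem_wordSpan (a : Alg k r) : ∃ m, a ∈ wordSpan k r m := by
  obtain ⟨a, rfl⟩ := RingQuot.mkAlgHom_surjective k (AlgRel k r) a
  induction a using FreeAlgebra.induction with
  | grade0 c =>
    refine ⟨0, ?_⟩
    rw [AlgHom.commutes, Algebra.algebraMap_eq_smul_one]
    exact Submodule.smul_mem _ _ (one_mem_wordSpan 0)
  | grade1 x =>
    refine ⟨1, ?_⟩
    simpa [monToAlg_monOf] using monToAlg_mem_wordSpan (k := k) (r := r) (w := [x]) le_rfl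
  | mul a b ha hb =>
    obtain ⟨m, hm⟩ := ha
    obtain ⟨m', hm'⟩ := hb
    exact ⟨m + m', wordSpan_mul_le _ _ (by rw [map_mul]; exact Submodule.mul_mem_mul hm hm')⟩
  | add a b ha hb =>
    obtain ⟨m, hm⟩ := ha
    obtain ⟨m', hm'⟩ := hb
    refine ⟨max m m', ?_⟩
    rw [map_add]
    exact add_mem (wordSpan_mono (le_max_left _ _) hm) (wordSpan_mono (le_max_right _ _) hm')

theorem exists_le_wordSpan {V : Submodule k (Alg k r)} (hV : V.FG) :
    ∃ d, V ≤ wordSpan k r d := by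
  classical
  obtain ⟨s, rfl⟩ := hV
  choose m hm using exists_mem_wordSpan (k := k) (r := r)
  exact ⟨s.sup m, Submodule.span_le.2 fun a ha => wordSpan_mono (Finset.le_sup ha) (hm a)⟩

theorem sum_pow_le_wordSpan {V : Submodule k (Alg k r)} {d : ℕ} (hV : V ≤ wordSpan k r d)
    (m : ℕ) : ∑ i ∈ Finset.range (m + 1), V ^ i ≤ wordSpan k r (d * m) := by
  refine Finset.sum_induction _ (· ≤ wordSpan k r (d * m)) (fun _ _ ha hb => sup_le ha hb)
    bot_le fun i hi => ?_
  have hi' := Finset.mem_range.1 hi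
  exact (pow_le_pow_left' hV i).trans ((wordSpan_pow_le d i).trans
    (wordSpan_mono (Nat.mul_le_mul_left d (by omega))))

theorem wordSpan_le_span {m : ℕ} {T : Finset (Mon r)}
    (hT : ∀ w : List X, w.length ≤ m → (w.map (monOf r)).prod ∈ T) :
    wordSpan k r m ≤ Submodule.span k (monToAlg k r '' T) :=
  Submodule.span_mono fun _ ⟨w, hw, e⟩ => ⟨_, hT w hw, e⟩

theorem finrank_le_of_le_wordSpan {V : Submodule k (Alg k r)} {m : ℕ} (hV : V ≤ wordSpan k r m)
    {T : Finset (Mon r)} (hT : ∀ w : List X, w.length ≤ m → (w.map (monOf r)).prod ∈ T) :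
    Module.finrank k V ≤ T.card := by
  classical
  have h := hV.trans (wordSpan_le_span (k := k) hT)
  rw [← Finset.coe_image] at h
  exact (Submodule.finrank_mono h).trans
    ((finrank_span_finset_le_card _).trans Finset.card_image_le)

theorem tendsto_div_log_add (c e : ℝ) :
    Tendsto (fun m : ℕ => ((c / Real.log m + e : ℝ) : EReal)) atTop (𝓝 (e : EReal)) := by
  refine continuous_coe_real_ereal.continuousAt.tendsto.comp ?_
  have h : Tendsto (fun m : ℕ => Real.log m) atTop atTop :=
    Real.tendsto_log_atTop.comp tendsto_natCast_atTop_atTop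
  simpa using (h.const_div_atTop c).add_const e

theorem gkDim_le (C e : ℕ) (h : ∀ m : ℕ, ∃ T : Finset (Mon r), T.card ≤ C * (m + 1) ^ e ∧
    ∀ w : List X, w.length ≤ m → (w.map (monOf r)).prod ∈ T) :
    gkDim k (Alg k r) ≤ (e : EReal) := by
  refine iSup_le fun V => ?_
  obtain ⟨d, hd⟩ := exists_le_wordSpan V.2
  -- The summand `1` keeps `log K` nonnegative, which covers dimension `0`, where `Real.log 0 = 0`.
  let K : ℝ := C * (d + 1) ^ e + 1
  have hK : 1 ≤ K := le_add_of_nonneg_left (by positivity)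
  rw [← EReal.coe_natCast, ← (tendsto_div_log_add (Real.log K) (e : ℝ)).limsup_eq]
  refine limsup_le_limsup ?_
  filter_upwards [eventually_ge_atTop 2] with m hm
  rw [EReal.coe_le_coe_iff]
  have hm2 : (2 : ℝ) ≤ m := by exact_mod_cast hm
  have hlog : 0 < Real.log m := Real.log_pos (by linarith)
  rw [div_add' _ _ _ hlog.ne', div_le_div_iff_of_pos_right hlog, ← Real.log_pow,
    ← Real.log_mul (by positivity) (by positivity)]
  obtain ⟨T, hT, hmem⟩ := h (d * m)
  have h1 := (finrank_le_of_le_wordSpan (sum_pow_le_wordSpan hd m) hmem).trans hT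
  set f := Module.finrank k (∑ i ∈ Finset.range (m + 1), V.1 ^ i : Submodule k (Alg k r))
  have h2 : (f : ℝ) ≤ K * (m : ℝ) ^ e := by
    calc (f : ℝ) ≤ C * (d * m + 1) ^ e := by exact_mod_cast h1
      _ ≤ C * ((d + 1) * m) ^ e := by
          gcongr
          nlinarith
      _ = C * (d + 1) ^ e * m ^ e := by rw [mul_pow, mul_assoc]
      _ ≤ K * (m : ℝ) ^ e := by
          gcongr
          exact le_add_of_nonneg_right zero_le_one
  rcases Nat.eq_zero_or_pos f with h0 | h0
  · rw [h0, Nat.cast_zero, Real.log_zero]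
    refine Real.log_nonneg (one_le_mul_of_one_le_of_one_le hK (one_le_pow₀ (by linarith)))
  · exact Real.log_le_log (by exact_mod_cast h0) h2

theorem gkDim_le_card [Fintype X] (hb : IsBraidedSet r) (hn : IsNonDegenerate r)
    (hs : IsSquareFree r) : gkDim k (Alg k r) ≤ (Fintype.card X : EReal) :=
  gkDim_le 1 _ fun m => by simpa using exists_finset_mon hb hn hs m

theorem gkDim_lt_card [Fintype X] [Nonempty X] (hb : IsBraidedSet r) (hn : IsNonDegenerate r)
    (hs : IsSquareFree r) (hr : ¬ Function.Involutive r) :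
    gkDim k (Alg k r) < (Fintype.card X : EReal) := by
  obtain ⟨C, hC⟩ := exists_finset_mon_of_not_involutive hb hn hs hr
  refine (gkDim_le C _ hC).trans_lt ?_
  exact_mod_cast Nat.sub_lt Fintype.card_pos one_pos

theorem exists_word_eq_sweep (hb : IsBraidedSet r) (hn : IsNonDegenerate r) (l : List X) :
    ∃ w : List X, w.length = l.length ∧
      (w.map (monOf r)).prod = ((l.map (sweep hb hn)).prod.unop : Mon r → Mon r) 1 := by
  induction l using List.reverseRecOn with
  | nil => exact ⟨[], rfl, rfl⟩
  | append_singleton l x ih =>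
    obtain ⟨w, hw, e⟩ := ih
    exact ⟨w ++ [(monPerm hb hn (w.map (monOf r)).prod)⁻¹ x], by simp [hw], by
      rw [sweep_append_apply, ← e, List.map_append, List.prod_append]
      simp⟩

/-- An involutive solution has at least `(j + 1) ^ n` monomials of length at most `n j`. -/
theorem exists_injective_words [Fintype X] (hb : IsBraidedSet r) (hn : IsNonDegenerate r)
    (hs : IsSquareFree r) (hr : Function.Involutive r) (j : ℕ) :
    ∃ w : (X → Fin (j + 1)) → List X, (∀ f, (w f).length ≤ Fintype.card X * j) ∧
      Function.Injective fun f => ((w f).map (monOf r)).prod := by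
  classical
  -- The monomials with all exponents at most `j`; the cocycle recovers the exponents.
  let l : (X → Fin (j + 1)) → List X := fun f =>
    (∑ x, Multiset.replicate (f x : ℕ) x).toList
  choose w hw e using exists_word_eq_sweep hb hn
  refine ⟨fun f => w (l f), fun f => ?_, fun f g h => ?_⟩
  · rw [hw, Multiset.length_toList, Multiset.card_sum]
    simp only [Multiset.card_replicate]
    calc ∑ x, (f x : ℕ) ≤ ∑ _x : X, j := Finset.sum_le_sum fun x _ => by omega
      _ = Fintype.card X * j := by simp
  · have h1 := congrArg (fun s => (monToWreath hb hn hs hr s).left) h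
    simp only [e, monToWreath_sweep_left] at h1
    have h2 := Multiset.coe_eq_coe.2 (perm_of_prod_basisElt_eq h1)
    simp only [l, Multiset.coe_toList] at h2
    funext x
    have h3 := congrArg (Multiset.count x) h2
    simpa [Multiset.count_sum', Multiset.count_replicate, Fin.ext_iff] using h3

theorem wordSpan_one_fg [Finite X] : (wordSpan k r 1).FG := by
  refine Submodule.fg_span (((List.finite_length_le X 1).image
    fun w => monToAlg k r (w.map (monOf r)).prod).subset ?_)
  rintro _ ⟨w, hw, rfl⟩
  exact ⟨w, hw, rfl⟩

theorem monToAlg_mem_pow (w : List X) :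
    monToAlg k r (w.map (monOf r)).prod ∈ wordSpan k r 1 ^ w.length := by
  induction w with
  | nil => simpa using Submodule.one_le.1 (le_refl (1 : Submodule k (Alg k r)))
  | cons x w ih =>
    rw [List.map_cons, List.prod_cons, map_mul, List.length_cons, pow_succ']
    refine Submodule.mul_mem_mul ?_ ih
    simpa using monToAlg_mem_wordSpan (k := k) (r := r) (w := [x]) le_rfl

theorem pow_le_finrank [Fintype X] (hb : IsBraidedSet r) (hn : IsNonDegenerate r)
    (hs : IsSquareFree r) (hr : Function.Involutive r) {j m : ℕ} (hm : Fintype.card X * j ≤ m) :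
    (j + 1) ^ Fintype.card X ≤ Module.finrank k
      (∑ i ∈ Finset.range (m + 1), wordSpan k r 1 ^ i : Submodule k (Alg k r)) := by
  classical
  obtain ⟨w, hw, hinj⟩ := exists_injective_words hb hn hs hr j
  have hli := (linearIndependent_monToAlg (k := k) (r := r)).comp _ hinj
  -- The upper bound supplies finite-dimensionality, without which `finrank` would be `0`.
  obtain ⟨T, -, hT⟩ := exists_finset_mon hb hn hs (1 * m)
  have hle := (sum_pow_le_wordSpan (le_refl (wordSpan k r 1)) m).trans
    (wordSpan_le_span (k := k) hT)
  have hfin : Module.Finite k (Submodule.span k (monToAlg k r '' (T : Set (Mon r)))) :=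
    Module.Finite.span_of_finite k (T.finite_toSet.image _)
  have hfin' := Submodule.finiteDimensional_of_le hle
  have h := finrank_span_eq_card hli
  rw [Fintype.card_fun, Fintype.card_fin] at h
  rw [← h]
  refine Submodule.finrank_mono (Submodule.span_le.2 ?_)
  rintro _ ⟨f, rfl⟩
  exact Finset.single_le_sum_of_canonicallyOrdered
    (f := fun i => wordSpan k r 1 ^ i) (Finset.mem_range.2 (Nat.lt_succ_of_le ((hw f).trans hm)))
    (monToAlg_mem_pow (w f))

theorem card_le_gkDim [Fintype X] [Nonempty X] (hb : IsBraidedSet r) (hn : IsNonDegenerate r)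
    (hs : IsSquareFree r) (hr : Function.Involutive r) :
    (Fintype.card X : EReal) ≤ gkDim k (Alg k r) := by
  refine le_trans ?_ (le_iSup _ ⟨wordSpan k r 1, wordSpan_one_fg⟩)
  set n := Fintype.card X with hn'
  have hn0 : 0 < n := Fintype.card_pos
  -- The dimension is at least `(m / n)ⁿ`, whose logarithm is `n log m - n log n`.
  rw [← EReal.coe_natCast, ← (tendsto_div_log_add (-(n * Real.log n)) (n : ℝ)).limsup_eq]
  refine limsup_le_limsup ?_
  filter_upwards [eventually_ge_atTop 2] with m hm
  rw [EReal.coe_le_coe_iff]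
  have hm2 : (2 : ℝ) ≤ m := by exact_mod_cast hm
  have hlog : 0 < Real.log m := Real.log_pos (by linarith)
  have hn0' : (0 : ℝ) < n := by exact_mod_cast hn0
  rw [div_add' _ _ _ hlog.ne', div_le_div_iff_of_pos_right hlog, neg_add_eq_sub, ← mul_sub,
    ← Real.log_div (by linarith) hn0'.ne', ← Real.log_pow]
  have h1 := pow_le_finrank (k := k) hb hn hs hr (Nat.mul_div_le m (Fintype.card X))
  rw [← hn'] at h1
  refine Real.log_le_log (by positivity) (le_trans ?_ (Nat.cast_le.2 h1))
  push_cast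
  gcongr
  rw [div_le_iff₀ hn0']
  have := Nat.lt_div_mul_add (a := m) hn0
  have h3 : m ≤ (m / n + 1) * n := by rw [add_mul, one_mul]; exact this.le
  exact_mod_cast h3

end Algebra

end BraidedSet

/-! ### The equivalences and the braided structures on `S` and `G`. -/

theorem mainTheorem8 {X : Type*} [Fintype X] [Nonempty X] (r : X × X → X × X)
    (hbraided : BraidedSet.IsBraidedSet r) (hnondeg : BraidedSet.IsNonDegenerate r)
    (hsqfree : BraidedSet.IsSquareFree r) (k : Type*) [Field k] :
    List.TFAE
      [∀ a x y : X,
          BraidedSet.monOf r a * BraidedSet.monOf r x ^ BraidedSet.actionLcm r =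
            BraidedSet.monOf r a * BraidedSet.monOf r y ^ BraidedSet.actionLcm r → x = y,
        ∀ a x y : X,
          BraidedSet.monOf r x ^ BraidedSet.actionLcm r * BraidedSet.monOf r a =
            BraidedSet.monOf r y ^ BraidedSet.actionLcm r * BraidedSet.monOf r a → x = y,
        IsCancelMul (BraidedSet.Mon r),
        BraidedSet.gkDim k (BraidedSet.Alg k r) = (Fintype.card X : EReal),
        Function.Involutive r] ∧
    (Function.Involutive r →
      Function.Injective (BraidedSet.monToGrp r) ∧
      ∃ (rS : BraidedSet.Mon r × BraidedSet.Mon r → BraidedSet.Mon r × BraidedSet.Mon r)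
        (rG : BraidedSet.Grp r × BraidedSet.Grp r → BraidedSet.Grp r × BraidedSet.Grp r),
        -- `rS` is the braiding of the associated braided monoid, `rG` that of the braided group
        (∀ R, BraidedSet.IsBraidedExtension r (BraidedSet.monOf r) R ↔ R = rS) ∧
        (∀ R, BraidedSet.IsBraidedExtension r (BraidedSet.grpOf r) R ↔ R = rG) ∧
        -- the embedding respects the braidings
        (∀ u v, rG (BraidedSet.monToGrp r u, BraidedSet.monToGrp r v) =
          (BraidedSet.monToGrp r (rS (u, v)).1, BraidedSet.monToGrp r (rS (u, v)).2)) ∧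
        BraidedSet.IsBraidedSet rS ∧ BraidedSet.IsNonDegenerate rS ∧ Function.Involutive rS ∧
        BraidedSet.IsBraidedSet rG ∧ BraidedSet.IsNonDegenerate rG ∧ Function.Involutive rG) := by
  open BraidedSet in
  have hp := (actionLcm_pos hnondeg).ne'
  refine ⟨?_, fun hr => ?_⟩
  · tfae_have 1 → 5 := involutive_of_mul_pow hbraided hnondeg hsqfree
    tfae_have 2 → 5 := involutive_of_pow_mul hbraided hnondeg hsqfree
    tfae_have 5 → 3 := fun hr => (isCocycle_monToWreath hbraided hnondeg hsqfree hr).isCancelMul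
    tfae_have 3 → 1 := fun _ a x y h =>
      eq_of_monOf_pow_eq hbraided hsqfree hp (mul_left_cancel h)
    tfae_have 3 → 2 := fun _ a x y h =>
      eq_of_monOf_pow_eq hbraided hsqfree hp (mul_right_cancel h)
    tfae_have 5 → 4 := fun hr => le_antisymm (gkDim_le_card hbraided hnondeg hsqfree)
      (card_le_gkDim hbraided hnondeg hsqfree hr)
    tfae_have 4 → 5 := fun h => by
      by_contra hr
      exact (gkDim_lt_card (k := k) hbraided hnondeg hsqfree hr).ne h
    tfae_finish
  · have hS := isCocycle_monToWreath hbraided hnondeg hsqfree hr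
    have hG := isCocycle_grpToWreath hbraided hnondeg hsqfree hr
    have eS : IsBraidedExtension r (monOf r) hS.braiding :=
      isBraidedExtension_of_isCocycle hnondeg hS
        (monToWreath_monOf hbraided hnondeg hsqfree hr) (monOf_mul_monOf r)
    have eG : IsBraidedExtension r (grpOf r) hG.braiding :=
      isBraidedExtension_of_isCocycle hnondeg hG
        (grpToWreath_grpOf hbraided hnondeg hsqfree hr) (grpOf_mul_grpOf r)
    exact ⟨monToGrp_injective hbraided hnondeg hsqfree hr, hS.braiding, hG.braiding,
      fun R => ⟨fun h => isBraidedExtension_mon_unique h eS, fun h => h ▸ eS⟩,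
      fun R => ⟨fun h => isBraidedExtension_grp_unique hnondeg h eG, fun h => h ▸ eG⟩,
      hS.map_braiding hG fun _ => rfl,
      eS.1.braided, hS.isNonDegenerate_of_hom hG fun _ => rfl, hS.involutive,
      eG.1.braided, hG.isNonDegenerate_of_group, hG.involutive⟩
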